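/- There are universal constants $c, c' > 0$ such that the following holds. **Setting.** Let $\mathbb{X}$ (states) and $\mathbb{A}$ (actions) be measurable spaces, where the $\sigma$-algebra of $\mathbb{X}$ contains a countable family separating points (e.g. a finite set or a standard Borel space), let $\lambda$ be an s-finite base measure on $\mathbb{A}$ (e.g. counting or Lebesgue measure), let $\pi(s,\cdot)$ be for each $s$ a probability density with respect to $\lambda$, and let $g:\mathbb{X}\times\mathbb{A}\to\mathbb{R}$ be a weight function with $g(s,a)=0$ whenever $\pi(s,a)=0$ (with the convention $g/\pi = g^2/\pi = 0$ there). For a probability measure $\xi$ on $\mathbb{X}$ and $\mu:\mathbb{X}\times\mathbb{A}\to\mathbb{R}$ put $$\langle g(s,\cdot),\mu(s,\cdot)\rangle=\int_{\mathbb{A}} g(s,a)\mu(s,a)\,d\lambda(a),\qquad \tau(\xi,\mu)=\int_{\mathbb{A}}\mathbb{E}_{X\sim\xi}[g(X,a)\mu(X,a)]\,d\lambda(a).$$ Fix a target pair $(\xi^*,\mu^*)$ with $g\mu^*\in L^1(\xi^*\otimes\lambda)$, a conditional standard deviation $\sigma:\mathbb{X}\times\mathbb{A}\to\mathbb{R}$,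 and an error function $\delta:\mathbb{X}\times\mathbb{A}\to[0,\infty)$; all functions are measurable. Let $$\|h\|_\omega^2=\int_{\mathbb{A}}\mathbb{E}_{\xi^*}\Big[\frac{g^2(X,a)}{\pi(X,a)}h^2(X,a)\Big]d\lambda(a),\qquad v_*^2=\mathrm{Var}_{\xi^*}\big(\langle g(X,\cdot),\mu^*(X,\cdot)\rangle\big)+\|\sigma\|_\omega^2,$$ and assume $\|\sigma\|_\omega<\infty$. **Risk.** Let $n\ge 1$, and let $\mathcal{K}$ be any class of conditional laws of a real outcome $Y$ given $(X,A)$ that contains the Gaussian laws $Y\mid X=s,A=a\sim N(\mu(s,a),\sigma^2(s,a))$ for all measurable $\mu$ with $|\mu-\mu^*|\le\delta$ pointwise. The local class $\mathcal{C}_\delta$ consists of all $(\xi,\mu,\kappa)$ such that $\xi$ is a probability measure with $\mathrm{KL}(\xi\,\|\,\xi^*)\le 1/n$, $\mu$ is measurable with $|\mu(s,a)-\mu^*(s,a)|\le\delta(s,a)$ for all $(s,a)$, $g\mu\in L^1(\xi\otimes\lambda)$, and $\kappa\in\mathcal{K}$ has conditional mean $\mu$ and conditional variance $\sigma^2$.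 One observes $n$ i.i.d. triples $(X_i,A_i,Y_i)$ with $X_i\sim\xi$, $A_i\mid X_i\sim\pi(X_i,\cdot)$, $Y_i\mid X_i,A_i\sim\kappa$, and $$\mathscr{M}_n=\inf_{\hat\tau_n}\ \sup_{(\xi,\mu,\kappa)\in\mathcal{C}_\delta}\mathbb{E}\,|\tau(\xi,\mu)-\hat\tau_n|^2,$$ the infimum being over all measurable functions $\hat\tau_n$ of the data. **Assumptions.** 1. (Moment ratios) With $X\sim\xi^*$ and $A\mid X\sim\pi(X,\cdot)$, the variables $Z=\delta(X,A)g(X,A)/\pi(X,A)$ and $Z'=\langle\mu^*(X,\cdot),g(X,\cdot)\rangle-\tau(\xi^*,\mu^*)$ have finite fourth moments; put $M=\sqrt{\mathbb{E}[Z^4]}/\mathbb{E}[Z^2]$ and $M'=\sqrt{\mathbb{E}[Z'^4]}/\mathbb{E}[Z'^2]$ (read as $0$ if the variable vanishes almost surely). 2. (Compatibility) $c_{\max}>0$. If $\mathbb{X}$ is finite, $\xi^*(\{s\})\le c_{\max}/|\mathbb{X}|$ for all $s$; if $\mathbb{X}$ is infinite, $\xi^*(\{s\})=0$ for all $s$,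 and $c_{\max}=1$. 3. (Neighborhood size) For all $(s,a)$, $\displaystyle \sqrt{n}\,\delta(s,a)\ \ge\ \frac{|g(s,a)|\,\sigma^2(s,a)}{\pi(s,a)\,\|\sigma\|_\omega}$ (the right-hand side being read as $0$ where its denominator vanishes). **Conclusion.** If $n\ge c'\max\{M'^2,M^2\}$, then $$\mathscr{M}_n\ \ge\ \frac{c}{n}\,v_*^2,$$ and if in addition $\mathbb{X}$ is infinite or $n<|\mathbb{X}|/c_{\max}$, then $$\mathscr{M}_n\ \ge\ \frac{c}{n}\big(v_*^2+\|\delta\|_\omega^2\big).$$ -/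

import Mathlib

open MeasureTheory ProbabilityTheory
open scoped ENNReal NNReal

noncomputable section

namespace LocalMinimax

variable {X A : Type*} [MeasurableSpace X] [MeasurableSpace A]

/-- The inner product `⟨h₁(s, ·), h₂(s, ·)⟩ = ∫ h₁(s, a) h₂(s, a) dλ(a)` over actions, as a function
of the state `s`. -/
def actionInner (lam : Measure A) (h₁ h₂ : X × A → ℝ) (s : X) : ℝ :=
  ∫ a, h₁ (s, a) * h₂ (s, a) ∂lam

/-- The linear functional `τ(ξ, μ) = ∫_A E_ξ[g(X, a) μ(X, a)] dλ(a)`. -/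
def tau (lam : Measure A) (g : X × A → ℝ) (ξ : Measure X) (mu : X × A → ℝ) : ℝ :=
  ∫ a, ∫ s, g (s, a) * mu (s, a) ∂ξ ∂lam

/-- The squared weighted norm `‖h‖_ω² = ∫_A E_ξ[g²(X, a) / π(X, a) · h²(X, a)] dλ(a)`. -/
def weightedNormSq (lam : Measure A) (pol g : X × A → ℝ) (ξ : Measure X) (h : X × A → ℝ) : ℝ :=
  ∫ a, ∫ s, g (s, a) ^ 2 / pol (s, a) * h (s, a) ^ 2 ∂ξ ∂lam

/-- The weighted norm `‖h‖_ω`. -/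
def weightedNorm (lam : Measure A) (pol g : X × A → ℝ) (ξ : Measure X) (h : X × A → ℝ) : ℝ :=
  Real.sqrt (weightedNormSq lam pol g ξ h)

/-- The efficient variance `v² = Var_ξ(⟨g(X, ·), μ(X, ·)⟩) + ‖σ‖_ω²`; `sig` is the conditional
standard deviation `σ`. -/
def efficientVar (lam : Measure A) (pol g : X × A → ℝ) (ξ : Measure X) (mu sig : X × A → ℝ) : ℝ :=
  Var[actionInner lam g mu; ξ] + weightedNormSq lam pol g ξ sig

/-- The `(2,4)`-moment ratio `√E[Y⁴] / E[Y²]`; it is `0` for an almost surely vanishing variable. -/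
def momentRatio {Ω : Type*} [MeasurableSpace Ω] (P : Measure Ω) (Y : Ω → ℝ) : ℝ :=
  Real.sqrt (∫ ω, Y ω ^ 4 ∂P) / ∫ ω, Y ω ^ 2 ∂P

/-- The law of the state-action pair: `X ∼ ξ`, and given `X = s` the action has density `π(s, ·)`
with respect to `λ`. -/
def stateActionLaw (lam : Measure A) (pol : X × A → ℝ) (ξ : Measure X) : Measure (X × A) :=
  (ξ.prod lam).withDensity fun p => ENNReal.ofReal (pol p)

/-- The random variable `Z(X, A) = δ(X, A) g(X, A) / π(X, A)`. -/
def perturbVar (pol g del : X × A → ℝ) (p : X × A) : ℝ :=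
  del p * g p / pol p

/-- The random variable `Z'(X) = ⟨μ(X, ·), g(X, ·)⟩ - τ(ξ, μ)`. -/
def centeredVar (lam : Measure A) (g : X × A → ℝ) (ξ : Measure X) (mu : X × A → ℝ) (s : X) : ℝ :=
  actionInner lam mu g s - tau lam g ξ mu

/-- The law of one observation `(X, A, Y)`, where `κ` is the conditional law of `Y` given
`(X, A)`. -/
def sampleLaw (lam : Measure A) (pol : X × A → ℝ) (ξ : Measure X) (κ : Kernel (X × A) ℝ) :
    Measure ((X × A) × ℝ) :=
  (stateActionLaw lam pol ξ).compProd κ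

/-- `κ` is a conditional law of the outcome with conditional mean `μ` and conditional variance
`σ²`. -/
def HasCondMoments (κ : Kernel (X × A) ℝ) (mu sig : X × A → ℝ) : Prop :=
  IsMarkovKernel κ ∧
    ∀ p, MemLp id 2 (κ p) ∧ ∫ y, y ∂(κ p) = mu p ∧ Var[id; κ p] = sig p ^ 2

/-- The Gaussian conditional law `Y ∣ X = s, A = a ∼ N(μ(s, a), σ²(s, a))`. -/
def gaussianOutcome (mu sig : X × A → ℝ) (hmu : Measurable mu) (hsig : Measurable sig) :
    Kernel (X × A) ℝ where
  toFun p := gaussianReal (mu p) (Real.toNNReal (sig p ^ 2))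
  measurable' :=
    measurable_gaussianReal.comp (hmu.prodMk (hsig.pow_const 2).real_toNNReal)

/-- The pointwise band `{μ : |μ - μ*| ≤ δ}` of (measurable) outcome functions. -/
def valueNbhd (muStar del : X × A → ℝ) : Set (X × A → ℝ) :=
  {mu | Measurable mu ∧ ∀ p, |mu p - muStar p| ≤ del p}

/-- The Kullback-Leibler neighborhood `{ξ : KL(ξ ‖ ξ*) ≤ 1/n}` of probability measures. -/
def probNbhd (n : ℕ) (ξStar : Measure X) : Set (Measure X) :=
  {ξ | IsProbabilityMeasure ξ ∧ InformationTheory.klDiv ξ ξStar ≤ ((n : ℝ≥0∞))⁻¹}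

/-- A problem instance: state distribution, outcome function, and the conditional law of the
outcome. -/
structure ProblemInstance (X A : Type*) [MeasurableSpace X] [MeasurableSpace A] where
  /-- the distribution `ξ` of the state -/
  stateLaw : Measure X
  /-- the outcome function `μ` -/
  outcome : X × A → ℝ
  /-- the law of `Y` given state and action -/
  condLaw : Kernel (X × A) ℝ

/-- The local class: the pair `(ξ, μ)` ranges over the product of the two neighborhoods (with
`τ(ξ, μ)` well defined), and the conditional law of `Y` over the members of `K` with conditional mean
`μ` and conditional variance `σ²`. -/
def localClass (n : ℕ) (lam : Measure A) (g : X × A → ℝ) (K : Set (Kernel (X × A) ℝ))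
    (ξStar : Measure X) (muStar sig del : X × A → ℝ) : Set (ProblemInstance X A) :=
  {I | I.stateLaw ∈ probNbhd n ξStar ∧ I.outcome ∈ valueNbhd muStar del ∧
    Integrable (fun p => g p * I.outcome p) (I.stateLaw.prod lam) ∧
    I.condLaw ∈ K ∧ HasCondMoments I.condLaw I.outcome sig}

/-- The mean squared error `E|τ(I) - τ̂ₙ|²` of an estimator based on `n` i.i.d. observations. -/
def mse (n : ℕ) (lam : Measure A) (pol g : X × A → ℝ) (est : (Fin n → (X × A) × ℝ) → ℝ)
    (I : ProblemInstance X A) : ℝ≥0∞ :=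
  ∫⁻ d, ENNReal.ofReal (|tau lam g I.stateLaw I.outcome - est d| ^ 2)
    ∂(Measure.pi fun _ : Fin n => sampleLaw lam pol I.stateLaw I.condLaw)

/-- The minimax risk over a class of instances. The infimum is over all measurable estimators, which
may depend on everything except the instance. -/
def minimaxRisk (n : ℕ) (lam : Measure A) (pol g : X × A → ℝ) (C : Set (ProblemInstance X A)) :
    ℝ≥0∞ :=
  ⨅ est : {f : (Fin n → (X × A) × ℝ) → ℝ // Measurable f}, ⨆ I ∈ C, mse n lam pol g est.1 I

/-- The compatibility condition: no state has mass above `cmax / |X|` if the state space is finite,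
and no state has positive mass (and `cmax = 1`) if it is infinite. -/
def Compatible (ξ : Measure X) (cmax : ℝ) : Prop :=
  (Finite X → ∀ s, ξ.real {s} ≤ cmax / Nat.card X) ∧
    (Infinite X → cmax = 1 ∧ ∀ s, ξ {s} = 0)

end LocalMinimax

end

/-! Each of the three terms `Var ⟨g, μ*⟩`, `‖σ‖_ω²` and `‖δ‖_ω²` gets its own lower bound, and the
largest of three numbers is at least a third of their sum.

The noise and variance terms come from Le Cam's method with two instances with Gaussian outcomes
(`two_point_bound`). The second instance moves by order `1/√n` in the direction that changes `τ`
most for the information it reveals. For the noise, `μ*` is shifted by `(g/π) σ² / (√n ‖σ‖_ω)`; the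
neighborhood-size assumption says exactly that this stays in the band. For the variance, `ξ*` is
tilted by a density `1 + w`, with `w` proportional to a centred truncation of `Z'`. In both cases
the Hellinger affinity of the `n`-samples is at least `1/2`, while `τ` moves by order `√(variance /
n)`.

The band term needs a mixture, since `σ` may vanish and the data may then reveal `μ` at every
visited point. The space `X × A` is cut into cells, and `μ` is put on the boundary of the band, on a
random side in each cell. There are two priors: independent signs of means `u`, or of means `-u`.
Even with the noise disclosed, the data depend only on the signs of the visited cells, so the
estimator must guess the prior in order to predict the other cells (`bayesRisk_signs`). With `u`
close to `|Z| / √(n E Z²)` one has `E u² ≤ 1/n`, so the visited signs hardly separate the priors,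
but the predicted contributions to `τ` differ by order `√(‖δ‖_ω² / n)`. A given cell must stay
unvisited with a probability bounded below; refining the cells brings their mass near that of single
states, at most `1/n`. This is carried by `minimaxRisk_ge_of_cells`, `exists_levels` and
`minimaxRisk_ge_band`.

Fourth moments matter mainly through `integral_mul_truncate_ge`: truncating at scale `√(n E Z²)`
costs at most a fraction `M²/n` of the second moment. -/

noncomputable section

namespace LocalMinimax

/-! ### Random signs with a small bias -/

section Signs

variable {J : Type*} [Fintype J] [DecidableEq J]

/-- The sign `±1` coded by a Boolean. -/
def boolSign (b : Bool) : ℝ := if b then 1 else -1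

lemma boolSign_sq (b : Bool) : boolSign b ^ 2 = 1 := by cases b <;> simp [boolSign]

lemma abs_boolSign (b : Bool) : |boolSign b| = 1 := by cases b <;> simp [boolSign]

/-- The mass function of a random sign with mean `u`. -/
def signWeight (u : ℝ) (b : Bool) : ℝ := (1 + boolSign b * u) / 2

lemma signWeight_nonneg {u : ℝ} (h : |u| ≤ 1) (b : Bool) : 0 ≤ signWeight u b := by
  have := abs_le.1 h
  cases b <;> simp only [signWeight, boolSign] <;> norm_num <;> linarith

lemma sum_signWeight (u : ℝ) : ∑ b, signWeight u b = 1 := by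
  simp [signWeight, boolSign]; ring

lemma sum_signWeight_mul_boolSign (u : ℝ) : ∑ b, signWeight u b * boolSign b = u := by
  simp [signWeight, boolSign]; ring

/-- No dependence on `b` remains, so the geometric mean of the laws with means `u` and `-u` is a
symmetric weight of total mass `√(1 - u²)`, which is the affinity of one observed sign. -/
lemma signWeight_mul_neg (u : ℝ) (b : Bool) :
    signWeight u b * signWeight (-u) b = (1 - u ^ 2) / 4 := by
  have := boolSign_sq b
  simp only [signWeight]
  linear_combination (-u ^ 2 / 4) * this

lemma sum_prod_weight (w : J → Bool → ℝ) :
    ∑ ε : J → Bool, ∏ c, w c (ε c) = ∏ c, ∑ b, w c b := by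
  rw [Finset.prod_univ_sum, Fintype.piFinset_univ]

/-- The extra sign is absorbed into the factor at `c₀`, which leaves a product weight. Stating `hm`
without division allows any total mass. -/
lemma sum_prod_weight_mul_boolSign (w : J → Bool → ℝ) (c₀ : J) (m : ℝ)
    (hm : ∑ b, w c₀ b * boolSign b = m * ∑ b, w c₀ b) :
    ∑ ε : J → Bool, (∏ c, w c (ε c)) * boolSign (ε c₀) = m * ∏ c, ∑ b, w c b := by
  have h1 : ∀ ε : J → Bool, (∏ c, w c (ε c)) * boolSign (ε c₀) =
      ∏ c, (w c (ε c) * if c = c₀ then boolSign (ε c) else 1) := by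
    intro ε
    rw [Finset.prod_mul_distrib]
    simp
  simp_rw [h1]
  rw [sum_prod_weight fun c b => w c b * if c = c₀ then boolSign b else 1]
  rw [← Finset.mul_prod_erase _ _ (Finset.mem_univ c₀),
    ← Finset.mul_prod_erase Finset.univ (fun c => ∑ b, w c b) (Finset.mem_univ c₀), ← mul_assoc,
    ← hm]
  congr 1
  · simp
  · refine Finset.prod_congr rfl fun c hc => ?_
    simp [Finset.ne_of_mem_erase hc]

/-- A sum against a product weight of a function that depends on the coordinates in `D` only is
insensitive to the weights off `D`, provided their total masses agree. -/
lemma sum_prod_weight_congr (D : Finset J) (w w' : J → Bool → ℝ) (G : (J → Bool) → ℝ)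
    (hG : ∀ ε ε', (∀ c ∈ D, ε c = ε' c) → G ε = G ε')
    (hD : ∀ c ∈ D, w c = w' c) (hDc : ∀ c, c ∉ D → ∑ b, w c b = ∑ b, w' c b) :
    ∑ ε : J → Bool, (∏ c, w c (ε c)) * G ε = ∑ ε : J → Bool, (∏ c, w' c (ε c)) * G ε := by
  let e := Equiv.piEquivPiSubtypeProd (fun c => c ∈ D) (fun _ => Bool)
  have key : ∀ v : J → Bool → ℝ, ∑ ε : J → Bool, (∏ c, v c (ε c)) * G ε =
      ∑ a : ({c // c ∈ D} → Bool), (∏ c : {c // c ∈ D}, v c (a c)) *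
        G (e.symm (a, fun _ => true)) * ∏ c : {c // c ∉ D}, ∑ b, v c b := by
    intro v
    rw [← e.symm.sum_comp, Fintype.sum_prod_type]
    refine Finset.sum_congr rfl fun a _ => ?_
    rw [← sum_prod_weight (J := {c // c ∉ D}) fun c => v c, Finset.mul_sum]
    refine Finset.sum_congr rfl fun b _ => ?_
    have h1 : G (e.symm (a, b)) = G (e.symm (a, fun _ => true)) := by
      apply hG
      intro c hc
      simp [e, Equiv.piEquivPiSubtypeProd, hc]
    have h2 : ∏ c, v c (e.symm (a, b) c) =
        (∏ c : {c // c ∈ D}, v c (a c)) * ∏ c : {c // c ∉ D}, v c (b c) := by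
      rw [← Fintype.prod_subtype_mul_prod_subtype (fun c => c ∈ D)]
      congr 1
      · refine Finset.prod_congr (by ext; simp) fun c _ => ?_
        simp [e, Equiv.piEquivPiSubtypeProd]
      · refine Finset.prod_congr rfl fun c _ => ?_
        simp [e, Equiv.piEquivPiSubtypeProd, c.2]
    rw [h1, h2]; ring
  rw [key, key]
  refine Finset.sum_congr rfl fun a _ => ?_
  congr 1
  · congr 1
    exact Finset.prod_congr rfl fun c _ => by rw [hD c c.2]
  · exact Finset.prod_congr rfl fun c _ => hDc c c.2

/-- Expand `(√q |x| - |l| √s)² ≥ 0`. This is Cauchy-Schwarz linearized by a free parameter `l`, so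
that it can be summed or integrated term by term. -/
lemma two_mul_le_add_of_sq_eq {q s r x l : ℝ} (hq : 0 ≤ q) (hs : 0 ≤ s) (h : r ^ 2 = q * s) :
    2 * l * r * x ≤ q * x ^ 2 + l ^ 2 * s := by
  have h1 : |r| = √q * √s := by
    rw [← Real.sqrt_mul hq, ← h, Real.sqrt_sq_eq_abs]
  have h2 : l * r * x ≤ |l * x| * |r| := by
    rw [← abs_mul]; exact (le_of_eq (by ring)).trans (le_abs_self _)
  have h3 := sq_nonneg (√q * |x| - |l| * √s)
  have h4 := Real.sq_sqrt hq
  have h5 := Real.sq_sqrt hs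
  rw [h1, abs_mul] at h2
  have h6 : (√q * |x| - |l| * √s) ^ 2 = q * x ^ 2 + l ^ 2 * s - 2 * (|l| * |x| * (√q * √s)) := by
    have e1 := sq_abs x
    have e2 := sq_abs l
    calc _ = √q ^ 2 * |x| ^ 2 + |l| ^ 2 * √s ^ 2 - 2 * (|l| * |x| * (√q * √s)) := by ring
      _ = _ := by rw [h4, h5, e1, e2]
  nlinarith

/-- The mass function of independent signs with means `u c`. -/
def signsWeight {I : Type*} [Fintype I] (u : I → ℝ) (ε : I → Bool) : ℝ := ∏ c, signWeight (u c) (ε c)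

lemma signsWeight_nonneg {I : Type*} [Fintype I] {u : I → ℝ} (hu : ∀ c, |u c| ≤ 1)
    (ε : I → Bool) :
    0 ≤ signsWeight u ε :=
  Finset.prod_nonneg fun c _ => signWeight_nonneg (hu c) _

lemma sum_signsWeight (u : J → ℝ) : ∑ ε, signsWeight u ε = 1 := by
  simp_rw [signsWeight]
  rw [sum_prod_weight fun c => signWeight (u c)]
  exact Finset.prod_eq_one fun c _ => sum_signWeight _

/-- The Bayes risk for estimating `a + ∑ h c ε c`, where the signs `ε` have means `u` or `-u` with
probability one half each and only the signs in `D` are observed. -/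
lemma bayesRisk_signs (u h : J → ℝ) (hu : ∀ c, |u c| ≤ 1) (D : Finset J) (G : (J → Bool) → ℝ)
    (hG : ∀ ε ε', (∀ c ∈ D, ε c = ε' c) → G ε = G ε') (a l : ℝ) :
    2 * l * ((∏ c ∈ D, √(1 - u c ^ 2)) * ∑ c ∈ Dᶜ, h c * u c) ≤
      ∑ ε, (signsWeight u ε + signsWeight (-u) ε) / 2 *
        (a + ∑ c, h c * boolSign (ε c) - G ε) ^ 2 + l ^ 2 := by
  set ρ := ∏ c ∈ D, √(1 - u c ^ 2) with hρ
  -- Geometric mean of the two priors on the observed signs, the prior with means `u` on the others.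
  -- Its square is the density of the prior times that of `s`, as Cauchy-Schwarz requires.
  let w : (J → ℝ) → J → Bool → ℝ := fun u c b =>
    if c ∈ D then √(1 - u c ^ 2) / 2 else signWeight (u c) b
  let s : (J → ℝ) → J → Bool → ℝ := fun u c b =>
    if c ∈ D then signWeight (-u c) b else signWeight (u c) b
  have hsq : ∀ c, 0 ≤ 1 - u c ^ 2 := fun c => by
    have := sq_le_one_iff_abs_le_one (u c) |>.2 (hu c); linarith
  have main : ∀ v : J → ℝ, (∀ c, v c ^ 2 = u c ^ 2) → (∀ c, |v c| ≤ 1) → ∀ k : ℝ,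
      2 * k * ∑ ε : J → Bool, (∏ c, w v c (ε c)) * (a + ∑ c, h c * boolSign (ε c) - G ε) ≤
        ∑ ε, signsWeight v ε * (a + ∑ c, h c * boolSign (ε c) - G ε) ^ 2 + k ^ 2 := by
    intro v hv hv1 k
    have hs1 : ∑ ε : J → Bool, ∏ c, s v c (ε c) = 1 := by
      rw [sum_prod_weight]
      refine Finset.prod_eq_one fun c _ => ?_
      by_cases hc : c ∈ D <;> simp only [s, hc, if_true, if_false] <;> exact sum_signWeight _
    calc _ = ∑ ε : J → Bool,
          2 * k * (∏ c, w v c (ε c)) * (a + ∑ c, h c * boolSign (ε c) - G ε) := by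
          rw [Finset.mul_sum]; exact Finset.sum_congr rfl fun _ _ => by ring
      _ ≤ ∑ ε : J → Bool, (signsWeight v ε * (a + ∑ c, h c * boolSign (ε c) - G ε) ^ 2 +
          k ^ 2 * ∏ c, s v c (ε c)) := by
          refine Finset.sum_le_sum fun ε _ => two_mul_le_add_of_sq_eq (signsWeight_nonneg hv1 ε)
            (Finset.prod_nonneg fun c _ => ?_) ?_
          · by_cases hc : c ∈ D <;> simp only [s, hc, if_true, if_false]
            · exact signWeight_nonneg (by rw [abs_neg]; exact hv1 c) _
            · exact signWeight_nonneg (hv1 c) _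
          · rw [signsWeight, ← Finset.prod_mul_distrib, ← Finset.prod_pow]
            refine Finset.prod_congr rfl fun c _ => ?_
            by_cases hc : c ∈ D <;> simp only [w, s, hc, if_true, if_false]
            · rw [signWeight_mul_neg, div_pow, Real.sq_sqrt (by rw [hv]; exact hsq c)]
              norm_num
            · ring
      _ = _ := by rw [Finset.sum_add_distrib, ← Finset.mul_sum, hs1, mul_one]
  have tot : ∀ v : J → ℝ, (∀ c, v c ^ 2 = u c ^ 2) → ∏ c, ∑ b, w v c b = ρ := by
    intro v hv
    rw [hρ, ← Finset.prod_subset (Finset.subset_univ D)]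
    · refine Finset.prod_congr rfl fun c hc => ?_
      simp only [w, hc, hv, if_true, Fintype.sum_bool]
      ring
    · intro c _ hc
      simp only [w, hc, if_false]
      exact sum_signWeight _
  have mean : ∀ v : J → ℝ, (∀ c, v c ^ 2 = u c ^ 2) →
      ∑ ε : J → Bool, (∏ c, w v c (ε c)) * (a + ∑ c, h c * boolSign (ε c)) =
        ρ * (a + ∑ c ∈ Dᶜ, h c * v c) := by
    intro v hv
    simp_rw [mul_add, Finset.sum_add_distrib, ← Finset.sum_mul, sum_prod_weight, tot v hv,
      Finset.mul_sum]
    congr 1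
    rw [Finset.sum_comm, ← Finset.sum_subset (Finset.subset_univ Dᶜ)]
    · refine Finset.sum_congr rfl fun c hc => ?_
      have hc' : c ∉ D := by simpa using hc
      have := sum_prod_weight_mul_boolSign (w v) c (v c) (by
        simp only [w, hc', if_false]
        rw [sum_signWeight_mul_boolSign, sum_signWeight, mul_one])
      rw [tot v hv] at this
      calc _ = h c * ∑ ε : J → Bool, (∏ c, w v c (ε c)) * boolSign (ε c) := by
            rw [Finset.mul_sum]; exact Finset.sum_congr rfl fun _ _ => by ring
        _ = _ := by rw [this]; ring
    · intro c _ hc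
      have hc' : c ∈ D := by simpa using hc
      have := sum_prod_weight_mul_boolSign (w v) c 0 (by simp [w, hc', boolSign])
      calc _ = h c * ∑ ε : J → Bool, (∏ c, w v c (ε c)) * boolSign (ε c) := by
            rw [Finset.mul_sum]; exact Finset.sum_congr rfl fun _ _ => by ring
        _ = _ := by rw [this]; ring
  have hneg : ∀ c, (-u) c ^ 2 = u c ^ 2 := fun c => by simp
  -- The two weights `w u` and `w (-u)` agree on `D`, and `G` sees nothing else; hence the estimator
  -- cancels when the two bounds are added.
  have hGeq : ∑ ε : J → Bool, (∏ c, w u c (ε c)) * G ε =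
      ∑ ε : J → Bool, (∏ c, w (-u) c (ε c)) * G ε := by
    refine sum_prod_weight_congr D _ _ G hG (fun c hc => ?_) fun c hc => ?_
    · simp [w, hc]
    · simp only [w, hc, if_false, sum_signWeight]
  -- Opposite multipliers `l` and `-l` for the two priors: `a` and `G` cancel, while the means `±∑ h
  -- u` over the unobserved cells add up.
  have e1 := main u (fun _ => rfl) hu l
  have e2 := main (-u) hneg (fun c => by simpa using hu c) (-l)
  simp_rw [mul_sub, Finset.sum_sub_distrib] at e1 e2
  rw [mean u fun _ => rfl] at e1
  rw [mean (-u) hneg, ← hGeq] at e2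
  have e3 : ∑ c ∈ Dᶜ, h c * (-u) c = -∑ c ∈ Dᶜ, h c * u c := by simp
  rw [e3] at e2
  have e4 : ∑ ε, (signsWeight u ε + signsWeight (-u) ε) / 2 *
        (a + ∑ c, h c * boolSign (ε c) - G ε) ^ 2 =
      (∑ ε, signsWeight u ε * (a + ∑ c, h c * boolSign (ε c) - G ε) ^ 2 +
        ∑ ε, signsWeight (-u) ε * (a + ∑ c, h c * boolSign (ε c) - G ε) ^ 2) / 2 := by
    rw [← Finset.sum_add_distrib, Finset.sum_div]
    exact Finset.sum_congr rfl fun _ _ => by ring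
  rw [e4]
  linarith

end Signs

/-! ### Two-point lower bounds -/

lemma pi_withDensity {Ω : Type*} [MeasurableSpace Ω] (n : ℕ) (P : Measure Ω)
    [IsProbabilityMeasure P] (f : Ω → ℝ) (hf0 : ∀ x, 0 ≤ f x) (hf : Integrable f P) :
    (Measure.pi fun _ : Fin n => P.withDensity fun x => ENNReal.ofReal (f x)) =
      (Measure.pi fun _ : Fin n => P).withDensity fun d => ENNReal.ofReal (∏ k, f (d k)) := by
  have := isFiniteMeasure_withDensity_ofReal hf.2
  refine Measure.pi_eq fun s hs => ?_
  rw [withDensity_apply _ (MeasurableSet.univ_pi hs), ← lintegral_indicator (MeasurableSet.univ_pi hs)]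
  -- The indicator of a box is absorbed into the factors, so that Fubini applies to a product of
  -- one-variable functions.
  have h1 : ∀ d : Fin n → Ω, (Set.univ.pi s).indicator
      (fun d => ENNReal.ofReal (∏ k, f (d k))) d =
      ENNReal.ofReal (∏ k, (s k).indicator f (d k)) := by
    intro d
    by_cases hd : d ∈ Set.univ.pi s
    · rw [Set.indicator_of_mem hd]
      congr 1
      exact Finset.prod_congr rfl fun k _ => (Set.indicator_of_mem (hd k trivial) _).symm
    · rw [Set.indicator_of_notMem hd]
      simp only [Set.mem_pi, Set.mem_univ, true_implies, not_forall] at hd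
      obtain ⟨k, hk⟩ := hd
      rw [Finset.prod_eq_zero (Finset.mem_univ k) (Set.indicator_of_notMem hk _),
        ENNReal.ofReal_zero]
  simp_rw [h1]
  have h2 : ∀ k, Integrable ((s k).indicator f) P := fun k => hf.indicator (hs k)
  have h3 : ∀ k x, 0 ≤ (s k).indicator f x := fun k x => Set.indicator_nonneg (fun x _ => hf0 x) x
  rw [← ofReal_integral_eq_lintegral_ofReal (Integrable.fintype_prod_dep h2)
    (Filter.Eventually.of_forall fun d => Finset.prod_nonneg fun k _ => h3 k _),
    integral_fintype_prod_eq_prod (fun k => (s k).indicator f),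
    ENNReal.ofReal_prod_of_nonneg fun k _ => integral_nonneg (h3 k)]
  refine Finset.prod_congr rfl fun k _ => ?_
  rw [withDensity_apply _ (hs k), ofReal_integral_eq_lintegral_ofReal (h2 k)
    (Filter.Eventually.of_forall (h3 k)), ← lintegral_indicator (hs k)]
  refine lintegral_congr fun x => ?_
  by_cases hx : x ∈ s k <;> simp [hx]

lemma integrable_sqrt {Ω : Type*} [MeasurableSpace Ω] {P : Measure Ω} [IsFiniteMeasure P]
    {f : Ω → ℝ} (hf0 : ∀ x, 0 ≤ f x) (hf : Integrable f P) : Integrable (fun x => √(f x)) P := by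
  refine ((integrable_const (1 : ℝ)).add hf).mono'
    (Real.continuous_sqrt.comp_aestronglyMeasurable hf.1) (Filter.Eventually.of_forall fun x => ?_)
  rw [Real.norm_of_nonneg (Real.sqrt_nonneg _), Pi.add_apply]
  nlinarith [Real.sq_sqrt (hf0 x), sq_nonneg (√(f x) - 1)]

/-- Le Cam's two-point bound in terms of the Hellinger affinity of the laws of one observation. -/
lemma two_point_bound {Ω : Type*} [MeasurableSpace Ω] (n : ℕ) (P Q : Measure Ω)
    [IsProbabilityMeasure P] [IsProbabilityMeasure Q] (f : Ω → ℝ) (hfm : Measurable f)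
    (hf0 : ∀ x, 0 ≤ f x) (hQ : Q = P.withDensity fun x => ENNReal.ofReal (f x))
    (T : (Fin n → Ω) → ℝ) (hT : Measurable T) (a b : ℝ) (M : ℝ≥0∞)
    (hP : ∫⁻ d, ENNReal.ofReal (|a - T d| ^ 2) ∂(Measure.pi fun _ : Fin n => P) ≤ M)
    (hQM : ∫⁻ d, ENNReal.ofReal (|b - T d| ^ 2) ∂(Measure.pi fun _ : Fin n => Q) ≤ M) :
    ENNReal.ofReal ((b - a) ^ 2 / 4 * ((∫ x, √(f x) ∂P) ^ n) ^ 2) ≤ M := by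
  have hint : ∫⁻ x, ENNReal.ofReal (f x) ∂P = 1 := by
    have := measure_univ (μ := Q)
    rwa [hQ, withDensity_apply _ MeasurableSet.univ, setLIntegral_univ] at this
  have hf : Integrable f P :=
    ⟨hfm.aestronglyMeasurable, by
      rw [hasFiniteIntegral_iff_ofReal (Filter.Eventually.of_forall hf0), hint]
      exact ENNReal.one_lt_top⟩
  have hpi := pi_withDensity n P f hf0 hf
  rw [← hQ] at hpi
  set Pn := Measure.pi fun _ : Fin n => P
  set F : (Fin n → Ω) → ℝ := fun d => ∏ k, f (d k) with hF
  have hF0 : ∀ d, 0 ≤ F d := fun d => Finset.prod_nonneg fun k _ => hf0 _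
  have hFm : Measurable F := Finset.measurable_prod _ fun k _ => hfm.comp (measurable_pi_apply k)
  have hF1 : ∫⁻ d, ENNReal.ofReal (F d) ∂Pn = 1 := by
    have := measure_univ (μ := Measure.pi fun _ : Fin n => Q)
    rwa [hpi, withDensity_apply _ MeasurableSet.univ, setLIntegral_univ] at this
  have hFi : Integrable F Pn := Integrable.fintype_prod fun _ => hf
  have hsF : ∀ d, √(F d) = ∏ k, √(f (d k)) := fun d => by
    rw [hF, Real.sqrt_eq_rpow]
    simp_rw [Real.sqrt_eq_rpow]
    rw [Real.finsetProd_rpow _ _ fun k _ => hf0 _]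
  set ρ := (∫ x, √(f x) ∂P) ^ n with hρ
  have hρ' : ∫ d, √(F d) ∂Pn = ρ := by
    simp_rw [hsF]
    rw [integral_fintype_prod_eq_pow (fun x => √(f x)), Fintype.card_fin]
  -- The maximizer of `2 l (b - a) ρ - 2 l²`, which bounds the sum of the two risks from below.
  set l := (b - a) * ρ / 2 with hl
  rw [hpi, lintegral_withDensity_eq_lintegral_mul _ (by fun_prop) (by fun_prop)] at hQM
  -- Adding the two linearized inequalities removes the estimator, since `(T - a) + (b - T) = b -
  -- a`.
  have pw : ∀ d, ENNReal.ofReal (2 * l * (b - a) * √(F d)) ≤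
      ENNReal.ofReal (|a - T d| ^ 2) + ENNReal.ofReal (F d) * ENNReal.ofReal (|b - T d| ^ 2) +
        ENNReal.ofReal (l ^ 2) * (1 + ENNReal.ofReal (F d)) := by
    intro d
    have h0 := hF0 d
    have e1 := two_mul_le_add_of_sq_eq (q := 1) (s := F d) (r := √(F d)) (x := T d - a) (l := l)
      zero_le_one h0 (by rw [Real.sq_sqrt h0, one_mul])
    have e2 := two_mul_le_add_of_sq_eq (q := F d) (s := 1) (r := √(F d)) (x := b - T d) (l := l)
      h0 zero_le_one (by rw [Real.sq_sqrt h0, mul_one])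
    rw [← ENNReal.ofReal_mul h0, ← ENNReal.ofReal_one, ← ENNReal.ofReal_add zero_le_one h0,
      ← ENNReal.ofReal_mul (sq_nonneg l), ← ENNReal.ofReal_add (sq_nonneg _) (by positivity),
      ← ENNReal.ofReal_add (by positivity) (by positivity)]
    apply ENNReal.ofReal_le_ofReal
    rw [sq_abs, sq_abs]
    nlinarith
  have hρ0 : 0 ≤ ρ := pow_nonneg (integral_nonneg fun x => Real.sqrt_nonneg _) _
  have hl0 : 0 ≤ 2 * l * (b - a) := by
    rw [hl]; nlinarith [mul_nonneg (sq_nonneg (b - a)) hρ0]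
  have tot := lintegral_mono (μ := Pn) pw
  rw [lintegral_add_right _ (by fun_prop), lintegral_add_right _ (by fun_prop),
    lintegral_const_mul _ (by fun_prop), lintegral_add_right _ (by fun_prop), hF1,
    ← ofReal_integral_eq_lintegral_ofReal ((integrable_sqrt hF0 hFi).const_mul _)
      (Filter.Eventually.of_forall fun d => mul_nonneg hl0 (Real.sqrt_nonneg _)),
    integral_const_mul, hρ', lintegral_const, measure_univ, one_mul] at tot
  have tot2 : ENNReal.ofReal (2 * l * (b - a) * ρ) ≤ M + M + ENNReal.ofReal (l ^ 2) * (1 + 1) :=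
    tot.trans (by gcongr; exact hQM)
  rcases eq_or_ne M ⊤ with rfl | hM
  · exact le_top
  rw [← ENNReal.ofReal_toReal hM] at tot2 ⊢
  rw [← ENNReal.ofReal_one, ← ENNReal.ofReal_add zero_le_one zero_le_one,
    ← ENNReal.ofReal_mul (sq_nonneg l), ← ENNReal.ofReal_add ENNReal.toReal_nonneg
    ENNReal.toReal_nonneg, ← ENNReal.ofReal_add (by positivity) (by positivity),
    ENNReal.ofReal_le_ofReal_iff (by positivity)] at tot2
  apply ENNReal.ofReal_le_ofReal
  have : l ^ 2 = (b - a) ^ 2 * ρ ^ 2 / 4 := by rw [hl]; ring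
  have : 2 * l * (b - a) * ρ = (b - a) ^ 2 * ρ ^ 2 := by rw [hl]; ring
  linarith

/-! ### Gaussian laws -/

/-- Here `s` may be zero or negative. Writing the outcome through one fixed standard noise variable
lets all outcome functions share the same randomness. -/
lemma gaussianReal_eq_map (m s : ℝ) :
    gaussianReal m (Real.toNNReal (s ^ 2)) =
      (gaussianReal 0 1).map fun w => s * w + m := by
  have h1 : (fun w : ℝ => s * w + m) = (fun x => x + m) ∘ (fun w => s * w) := rfl
  rw [h1, ← Measure.map_map (by fun_prop) (by fun_prop), gaussianReal_map_const_mul,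
    gaussianReal_map_add_const]
  congr 1
  · simp
  · ext; simp [sq_nonneg]

/-- A Gaussian shift is an exponential tilt. Taking the shift of the form `θ v` keeps the formula
true for `v = 0`, where both laws are the same Dirac mass and the density is `1` at `m`. -/
lemma gaussianReal_add_mul_eq_withDensity (m θ : ℝ) (v : ℝ≥0) :
    gaussianReal (m + θ * v) v = (gaussianReal m v).withDensity fun y =>
      ENNReal.ofReal (Real.exp (θ * (y - m) - θ ^ 2 * v / 2)) := by
  by_cases hv : v = 0
  · subst hv
    have : (fun y => ENNReal.ofReal (Real.exp (θ * (y - m) - θ ^ 2 * ((0 : ℝ≥0) : ℝ) / 2))) =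
        fun y => ENNReal.ofReal (Real.exp (θ * (y - m))) := by simp
    rw [this]
    simp only [NNReal.coe_zero, mul_zero, add_zero, gaussianReal_zero_var]
    ext s hs
    classical
    rw [withDensity_apply _ hs, restrict_dirac' hs]
    by_cases hm : m ∈ s
    · rw [if_pos hm, lintegral_dirac' _ (by fun_prop)]
      simp [hm, Measure.dirac_apply' _ hs]
    · rw [if_neg hm]
      simp [hm, Measure.dirac_apply' _ hs]
  · rw [gaussianReal_of_var_ne_zero _ hv, gaussianReal_of_var_ne_zero _ hv,
      ← withDensity_mul _ (measurable_gaussianPDF _ _) (by fun_prop)]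
    congr 1
    ext y
    have hv' : (v : ℝ) ≠ 0 := by exact_mod_cast hv
    simp only [gaussianPDF, Pi.mul_apply, gaussianPDFReal]
    rw [← ENNReal.ofReal_mul (by positivity), mul_assoc _ (Real.exp _), ← Real.exp_add]
    congr 3
    field_simp
    ring

/-- The square root halves the tilt, so the Hellinger affinity is a Gaussian moment generating
function at `θ / 2`. -/
lemma integral_sqrt_exp_gaussianReal (m θ : ℝ) (v : ℝ≥0) :
    ∫ y, √(Real.exp (θ * (y - m) - θ ^ 2 * v / 2)) ∂(gaussianReal m v) =
      Real.exp (-(θ ^ 2 * v / 8)) := by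
  have h1 : ∀ y, √(Real.exp (θ * (y - m) - θ ^ 2 * v / 2)) =
      Real.exp (θ / 2 * y) * Real.exp (-(θ * m / 2) - θ ^ 2 * v / 4) := by
    intro y
    rw [← Real.exp_add, Real.sqrt_eq_rpow, ← Real.exp_mul]
    congr 1; ring
  simp_rw [h1]
  rw [integral_mul_const]
  have h2 := congrFun (mgf_fun_id_gaussianReal (μ := m) (v := v)) (θ / 2)
  simp only [mgf] at h2
  rw [h2, ← Real.exp_add]
  congr 1; ring

/-! ### State-action laws and sample laws -/

section Laws

variable {X A : Type*} [MeasurableSpace X] [MeasurableSpace A]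

lemma isProbabilityMeasure_stateActionLaw (lam : Measure A) [SFinite lam] {pol : X × A → ℝ}
    (hpol : Measurable pol) (hpol1 : ∀ s, ∫⁻ a, ENNReal.ofReal (pol (s, a)) ∂lam = 1)
    (ξ : Measure X) [IsProbabilityMeasure ξ] : IsProbabilityMeasure (stateActionLaw lam pol ξ) := by
  refine ⟨?_⟩
  rw [stateActionLaw, withDensity_apply _ MeasurableSet.univ, setLIntegral_univ,
    lintegral_prod _ (by fun_prop)]
  simp [hpol1]

lemma map_fst_stateActionLaw (lam : Measure A) [SFinite lam] {pol : X × A → ℝ}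
    (hpol : Measurable pol) (hpol1 : ∀ s, ∫⁻ a, ENNReal.ofReal (pol (s, a)) ∂lam = 1)
    (ξ : Measure X) [SFinite ξ] : (stateActionLaw lam pol ξ).map Prod.fst = ξ := by
  ext s hs
  rw [Measure.map_apply measurable_fst hs, stateActionLaw,
    withDensity_apply _ (measurable_fst hs), ← lintegral_indicator (measurable_fst hs),
    lintegral_prod _ (by
      refine (Measurable.indicator (by fun_prop) (measurable_fst hs)).aemeasurable)]
  have : ∀ x, ∫⁻ a, (Prod.fst ⁻¹' s).indicator (fun p : X × A => ENNReal.ofReal (pol p)) (x, a) ∂lam =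
      s.indicator 1 x := by
    intro x
    by_cases hx : x ∈ s <;> simp [Set.indicator, hx, hpol1]
  simp_rw [this]
  rw [lintegral_indicator_one hs]

lemma integral_stateActionLaw (lam : Measure A) {pol : X × A → ℝ}
    (hpol : Measurable pol) (hpol0 : ∀ p, 0 ≤ pol p) (ξ : Measure X) (F : X × A → ℝ) :
    ∫ p, F p ∂(stateActionLaw lam pol ξ) = ∫ p, pol p * F p ∂(ξ.prod lam) := by
  rw [stateActionLaw, integral_withDensity_eq_integral_toReal_smul (by fun_prop)
    (Filter.Eventually.of_forall fun _ => ENNReal.ofReal_lt_top)]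
  simp [ENNReal.toReal_ofReal (hpol0 _)]

lemma integrable_stateActionLaw_iff (lam : Measure A) {pol : X × A → ℝ}
    (hpol : Measurable pol) (hpol0 : ∀ p, 0 ≤ pol p) (ξ : Measure X) (F : X × A → ℝ) :
    Integrable F (stateActionLaw lam pol ξ) ↔ Integrable (fun p => pol p * F p) (ξ.prod lam) := by
  rw [stateActionLaw, integrable_withDensity_iff_integrable_smul' (by fun_prop)
    (Filter.Eventually.of_forall fun _ => ENNReal.ofReal_lt_top)]
  simp [ENNReal.toReal_ofReal (hpol0 _)]

lemma tau_eq_integral (lam : Measure A) [SFinite lam] {g mu : X × A → ℝ} (ξ : Measure X)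
    [SFinite ξ] (h : Integrable (fun p => g p * mu p) (ξ.prod lam)) :
    tau lam g ξ mu = ∫ p, g p * mu p ∂(ξ.prod lam) :=
  (integral_prod_symm _ h).symm

lemma tau_eq_integral_actionInner (lam : Measure A) [SFinite lam] {g mu : X × A → ℝ}
    (ξ : Measure X) [SFinite ξ] (h : Integrable (fun p => g p * mu p) (ξ.prod lam)) :
    tau lam g ξ mu = ∫ s, actionInner lam g mu s ∂ξ := by
  rw [tau_eq_integral lam ξ h, integral_prod _ h]
  rfl

lemma weightedNormSq_eq_integral (lam : Measure A) [SFinite lam] {pol g h : X × A → ℝ}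
    (ξ : Measure X) [SFinite ξ]
    (hi : Integrable (fun p => g p ^ 2 / pol p * h p ^ 2) (ξ.prod lam)) :
    weightedNormSq lam pol g ξ h = ∫ p, g p ^ 2 / pol p * h p ^ 2 ∂(ξ.prod lam) :=
  (integral_prod_symm _ hi).symm

instance isMarkovKernel_gaussianOutcome (mu sig : X × A → ℝ) (hmu : Measurable mu)
    (hsig : Measurable sig) : IsMarkovKernel (gaussianOutcome mu sig hmu hsig) :=
  ⟨fun p => by
    change IsProbabilityMeasure (gaussianReal _ _)
    infer_instance⟩

lemma gaussianOutcome_apply (mu sig : X × A → ℝ) (hmu : Measurable mu) (hsig : Measurable sig)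
    (p : X × A) :
    gaussianOutcome mu sig hmu hsig p = gaussianReal (mu p) (Real.toNNReal (sig p ^ 2)) := rfl

lemma hasCondMoments_gaussianOutcome (mu sig : X × A → ℝ) (hmu : Measurable mu)
    (hsig : Measurable sig) : HasCondMoments (gaussianOutcome mu sig hmu hsig) mu sig := by
  refine ⟨inferInstance, fun p => ⟨?_, ?_, ?_⟩⟩
  · exact memLp_id_gaussianReal 2
  · exact integral_id_gaussianReal
  · rw [gaussianOutcome_apply, variance_id_gaussianReal, Real.coe_toNNReal _ (sq_nonneg _)]

/-- Gaussian samples as a function of the state-action pair and standard Gaussian noise. -/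
lemma sampleLaw_gaussianOutcome_eq_map (lam : Measure A) (pol : X × A → ℝ)
    (ξ : Measure X) [IsProbabilityMeasure (stateActionLaw lam pol ξ)]
    (mu sig : X × A → ℝ) (hmu : Measurable mu) (hsig : Measurable sig) :
    sampleLaw lam pol ξ (gaussianOutcome mu sig hmu hsig) =
      ((stateActionLaw lam pol ξ).prod (gaussianReal 0 1)).map
        fun q => (q.1, sig q.1 * q.2 + mu q.1) := by
  have hm : Measurable fun q : (X × A) × ℝ => (q.1, sig q.1 * q.2 + mu q.1) := by fun_prop
  ext s hs
  rw [sampleLaw, Measure.compProd_apply hs, Measure.map_apply hm hs, Measure.prod_apply (hm hs)]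
  refine lintegral_congr fun p => ?_
  rw [gaussianOutcome_apply, gaussianReal_eq_map, Measure.map_apply (by fun_prop)
    (measurable_prodMk_left hs)]
  rfl

instance isProbabilityMeasure_sampleLaw (lam : Measure A) (pol : X × A → ℝ)
    (ξ : Measure X) [IsProbabilityMeasure (stateActionLaw lam pol ξ)]
    (κ : Kernel (X × A) ℝ) [IsMarkovKernel κ] : IsProbabilityMeasure (sampleLaw lam pol ξ κ) := by
  unfold sampleLaw; infer_instance

/-- The density of the sample law after a change of the state distribution. -/
lemma sampleLaw_withDensity (lam : Measure A) [SFinite lam] {pol : X × A → ℝ}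
    (hpol : Measurable pol) (ξ : Measure X) [SFinite ξ] (κ : Kernel (X × A) ℝ) [IsMarkovKernel κ]
    {r : X → ℝ} (hr : Measurable r) [IsProbabilityMeasure (stateActionLaw lam pol ξ)]
    [IsProbabilityMeasure
      (stateActionLaw lam pol (ξ.withDensity fun s => ENNReal.ofReal (r s)))] :
    sampleLaw lam pol (ξ.withDensity fun s => ENNReal.ofReal (r s)) κ =
      (sampleLaw lam pol ξ κ).withDensity fun d => ENNReal.ofReal (r d.1.1) := by
  have h1 : stateActionLaw lam pol (ξ.withDensity fun s => ENNReal.ofReal (r s)) =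
      (stateActionLaw lam pol ξ).withDensity fun p => ENNReal.ofReal (r p.1) := by
    rw [stateActionLaw, stateActionLaw, prod_withDensity_left (by fun_prop),
      ← withDensity_mul _ (by fun_prop) (by fun_prop),
      ← withDensity_mul _ (by fun_prop) (by fun_prop), mul_comm]
  ext s hs
  rw [withDensity_apply _ hs, ← lintegral_indicator hs, sampleLaw, Measure.compProd_apply hs,
    sampleLaw, Measure.lintegral_compProd (Measurable.indicator (by fun_prop) hs), h1,
    lintegral_withDensity_eq_lintegral_mul _ (by fun_prop)
      (Kernel.measurable_kernel_prodMk_left hs)]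
  refine lintegral_congr fun p => ?_
  have h2 : (fun y => s.indicator (fun d : (X × A) × ℝ => ENNReal.ofReal (r d.1.1)) (p, y)) =
      (Prod.mk p ⁻¹' s).indicator fun _ => ENNReal.ofReal (r p.1) := by
    ext y; rfl
  rw [h2, lintegral_indicator_const (measurable_prodMk_left hs), Pi.mul_apply]

/-- The density of the sample law after a change of the mean of Gaussian outcomes. -/
lemma sampleLaw_gaussianOutcome_shift (lam : Measure A) (pol : X × A → ℝ)
    (ξ : Measure X) [IsProbabilityMeasure (stateActionLaw lam pol ξ)]
    (mu sig θ mu' : X × A → ℝ) (hmu : Measurable mu) (hsig : Measurable sig) (hθ : Measurable θ)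
    (hmu' : Measurable mu') (h : ∀ p, mu' p = mu p + θ p * sig p ^ 2) :
    sampleLaw lam pol ξ (gaussianOutcome mu' sig hmu' hsig) =
      (sampleLaw lam pol ξ (gaussianOutcome mu sig hmu hsig)).withDensity fun d =>
        ENNReal.ofReal (Real.exp (θ d.1 * (d.2 - mu d.1) - θ d.1 ^ 2 * sig d.1 ^ 2 / 2)) := by
  ext s hs
  rw [withDensity_apply _ hs, ← lintegral_indicator hs, sampleLaw, Measure.compProd_apply hs,
    sampleLaw, Measure.lintegral_compProd (Measurable.indicator (by fun_prop) hs)]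
  refine lintegral_congr fun p => ?_
  have hc : ((Real.toNNReal (sig p ^ 2) : ℝ≥0) : ℝ) = sig p ^ 2 :=
    Real.coe_toNNReal _ (sq_nonneg _)
  have := gaussianReal_add_mul_eq_withDensity (mu p) (θ p) (Real.toNNReal (sig p ^ 2))
  rw [hc, ← h] at this
  rw [gaussianOutcome_apply, this, withDensity_apply _ (measurable_prodMk_left hs),
    ← lintegral_indicator (measurable_prodMk_left hs), gaussianOutcome_apply]
  rfl

lemma integral_sampleLaw_comp_fst (lam : Measure A) (pol : X × A → ℝ)
    (ξ : Measure X) [IsProbabilityMeasure (stateActionLaw lam pol ξ)]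
    (κ : Kernel (X × A) ℝ) [IsMarkovKernel κ] {F : X × A → ℝ} (hF : Measurable F) :
    ∫ d, F d.1 ∂(sampleLaw lam pol ξ κ) = ∫ p, F p ∂(stateActionLaw lam pol ξ) := by
  have h : (sampleLaw lam pol ξ κ).map Prod.fst = stateActionLaw lam pol ξ :=
    Measure.fst_compProd _ _
  rw [← h, integral_map measurable_fst.aemeasurable hF.aestronglyMeasurable]

lemma integral_stateActionLaw_comp_fst (lam : Measure A) [SFinite lam] {pol : X × A → ℝ}
    (hpol : Measurable pol) (hpol1 : ∀ s, ∫⁻ a, ENNReal.ofReal (pol (s, a)) ∂lam = 1)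
    (ξ : Measure X) [SFinite ξ] {F : X → ℝ} (hF : Measurable F) :
    ∫ p, F p.1 ∂(stateActionLaw lam pol ξ) = ∫ s, F s ∂ξ := by
  conv_rhs => rw [← map_fst_stateActionLaw lam hpol hpol1 ξ]
  rw [integral_map measurable_fst.aemeasurable hF.aestronglyMeasurable]

/-- The two-point bound for the minimax risk. -/
lemma minimaxRisk_ge_of_two_point (n : ℕ) (lam : Measure A) (pol g : X × A → ℝ)
    (C : Set (ProblemInstance X A)) (I₀ I₁ : ProblemInstance X A) (h₀ : I₀ ∈ C) (h₁ : I₁ ∈ C)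
    [IsProbabilityMeasure (sampleLaw lam pol I₀.stateLaw I₀.condLaw)]
    [IsProbabilityMeasure (sampleLaw lam pol I₁.stateLaw I₁.condLaw)]
    (f : (X × A) × ℝ → ℝ) (hfm : Measurable f) (hf0 : ∀ x, 0 ≤ f x)
    (hf : sampleLaw lam pol I₁.stateLaw I₁.condLaw =
      (sampleLaw lam pol I₀.stateLaw I₀.condLaw).withDensity fun x => ENNReal.ofReal (f x)) :
    ENNReal.ofReal ((tau lam g I₁.stateLaw I₁.outcome - tau lam g I₀.stateLaw I₀.outcome) ^ 2 / 4 *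
      ((∫ x, √(f x) ∂(sampleLaw lam pol I₀.stateLaw I₀.condLaw)) ^ n) ^ 2) ≤
      minimaxRisk n lam pol g C := by
  refine le_iInf fun est => ?_
  refine two_point_bound n _ _ f hfm hf0 hf est.1 est.2 _ _ _ ?_ ?_
  · exact le_iSup₂_of_le (f := fun I _ => mse n lam pol g est.1 I) I₀ h₀ le_rfl
  · exact le_iSup₂_of_le (f := fun I _ => mse n lam pol g est.1 I) I₁ h₁ le_rfl

lemma self_mem_probNbhd (n : ℕ) (ξ : Measure X) [IsProbabilityMeasure ξ] : ξ ∈ probNbhd n ξ :=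
  ⟨inferInstance, by rw [InformationTheory.klDiv_self]; exact bot_le⟩

/-- The problem instance with Gaussian outcomes. -/
def gaussianInstance (ξ : Measure X) (mu sig : X × A → ℝ) (hmu : Measurable mu)
    (hsig : Measurable sig) : ProblemInstance X A :=
  ⟨ξ, mu, gaussianOutcome mu sig hmu hsig⟩

/-- Bernoulli's inequality. It is applied with `x` the affinity of one observation. -/
lemma half_le_pow_of_one_sub_le {n : ℕ} (hn : 1 ≤ n) {x : ℝ} (hx : 1 - 1 / (2 * n) ≤ x) :
    1 / 2 ≤ x ^ n := by
  have hn' : (1 : ℝ) ≤ n := by exact_mod_cast hn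
  have h0 : (1 : ℝ) / (2 * n) ≤ 1 / 2 := by
    rw [div_le_div_iff₀ (by positivity) (by norm_num)]; linarith
  have h1 := one_add_mul_le_pow (a := -(1 / (2 * n : ℝ))) (by linarith) n
  have h2 : (1 + -(1 / (2 * n : ℝ))) ^ n ≤ x ^ n :=
    pow_le_pow_left₀ (by linarith) (by linarith) n
  have h3 : (n : ℝ) * -(1 / (2 * n)) = -(1 / 2) := by field_simp
  linarith

end Laws

/-! ### Fourth moments, truncation, and perturbed densities -/

section Moments

variable {Ω : Type*} [MeasurableSpace Ω] {P : Measure Ω} {Z : Ω → ℝ}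

lemma integrable_pow_four_of_memLp (h : MemLp Z 4 P) : Integrable (fun x => Z x ^ 4) P := by
  have := h.integrable_norm_pow (p := 4) (by norm_num)
  simpa [Real.norm_eq_abs, Even.pow_abs (by decide : Even 4)] using this

lemma integrable_sq_of_memLp [IsFiniteMeasure P] (h : MemLp Z 4 P) : Integrable (fun x => Z x ^ 2) P :=
  (h.mono_exponent (by norm_num : (2 : ℝ≥0∞) ≤ 4)).integrable_sq

lemma integral_pow_four_eq_momentRatio (hV : 0 < ∫ x, Z x ^ 2 ∂P) :
    ∫ x, Z x ^ 4 ∂P = momentRatio P Z ^ 2 * (∫ x, Z x ^ 2 ∂P) ^ 2 := by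
  rw [momentRatio, div_pow, Real.sq_sqrt (integral_nonneg fun x => by positivity),
    div_mul_cancel₀ _ (by positivity)]

/-- The smooth truncation `x / (1 + t² x²)`, bounded by `1 / (2 t)`. -/
def truncate (t x : ℝ) : ℝ := x / (1 + t ^ 2 * x ^ 2)

lemma measurable_truncate (t : ℝ) : Measurable (truncate t) := by
  unfold truncate; fun_prop

lemma abs_mul_truncate_le (t x : ℝ) : |t * truncate t x| ≤ 1 / 2 := by
  have h : 0 < 1 + t ^ 2 * x ^ 2 := by positivity
  rw [truncate, ← mul_div_assoc, abs_div, abs_of_pos h, div_le_div_iff₀ h (by norm_num)]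
  nlinarith [sq_abs (t * x), sq_nonneg (|t * x| - 1)]

lemma truncate_sq_le (t x : ℝ) : truncate t x ^ 2 ≤ x ^ 2 := by
  have h : 1 ≤ 1 + t ^ 2 * x ^ 2 := by nlinarith [mul_nonneg (sq_nonneg t) (sq_nonneg x)]
  rw [truncate, div_pow]
  exact div_le_self (sq_nonneg x) (one_le_pow₀ h)

lemma truncate_nonneg (t : ℝ) {x : ℝ} (hx : 0 ≤ x) : 0 ≤ truncate t x := by
  unfold truncate; positivity

lemma truncate_le_self (t : ℝ) {x : ℝ} (hx : 0 ≤ x) : truncate t x ≤ x := by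
  have h : 1 ≤ 1 + t ^ 2 * x ^ 2 := by nlinarith [mul_nonneg (sq_nonneg t) (sq_nonneg x)]
  exact div_le_self hx h

/-- With `y = t² x²` this is `(1 - y)(1 + y) ≤ 1`, multiplied by `x²`. -/
lemma sq_sub_le_mul_truncate (t x : ℝ) : x ^ 2 - t ^ 2 * x ^ 4 ≤ x * truncate t x := by
  have h : 0 < 1 + t ^ 2 * x ^ 2 := by positivity
  rw [truncate, ← mul_div_assoc, le_div_iff₀ h]
  nlinarith [mul_nonneg (sq_nonneg (t ^ 2)) (sq_nonneg (x ^ 3))]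

/-- Truncation at a level of order `√(n E Z²)` keeps most of the second moment. -/
lemma integral_mul_truncate_ge [IsFiniteMeasure P] (h : MemLp Z 4 P)
    (hV : 0 < ∫ x, Z x ^ 2 ∂P) {n : ℕ}
    (hM : 8 * momentRatio P Z ^ 2 ≤ n) {t : ℝ} (ht : t ^ 2 * (n * ∫ x, Z x ^ 2 ∂P) = 1)
    (hi : Integrable (fun x => Z x * truncate t (Z x)) P) :
    7 / 8 * ∫ x, Z x ^ 2 ∂P ≤ ∫ x, Z x * truncate t (Z x) ∂P := by
  have h4 := integral_pow_four_eq_momentRatio hV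
  have h1 : ∫ x, (Z x ^ 2 - t ^ 2 * Z x ^ 4) ∂P ≤ ∫ x, Z x * truncate t (Z x) ∂P :=
    integral_mono ((integrable_sq_of_memLp h).sub
      ((integrable_pow_four_of_memLp h).const_mul _)) hi fun x => sq_sub_le_mul_truncate t _
  rw [integral_sub (integrable_sq_of_memLp h) ((integrable_pow_four_of_memLp h).const_mul _),
    integral_const_mul, h4] at h1
  set V := ∫ x, Z x ^ 2 ∂P
  have h2 : t ^ 2 * (momentRatio P Z ^ 2 * V ^ 2) ≤ V / 8 := by
    calc _ = momentRatio P Z ^ 2 * (t ^ 2 * V ^ 2) := by ring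
      _ ≤ n / 8 * (t ^ 2 * V ^ 2) := by gcongr; linarith
      _ = (t ^ 2 * (n * V)) * V / 8 := by ring
      _ = _ := by rw [ht, one_mul]
  linarith

end Moments

/-- For a density `1 + w` with `w` of mean zero the linear term integrates to zero, so the affinity
is at least `1 - E w² / 2`. -/
lemma one_add_sub_sq_le_sqrt {x : ℝ} (h1 : -1 ≤ x) (h2 : x ≤ 1) :
    1 + x / 2 - x ^ 2 / 2 ≤ √(1 + x) := by
  apply Real.le_sqrt_of_sq_le
  have : (1 + x / 2 - x ^ 2 / 2) ^ 2 = (1 + x) - (1 + x) * (x ^ 2 * (3 - x)) / 4 := by ring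
  rw [this]
  have : 0 ≤ (1 + x) * (x ^ 2 * (3 - x)) :=
    mul_nonneg (by linarith) (mul_nonneg (sq_nonneg x) (by linarith))
  linarith

/-- Relative entropy is at most the chi-square divergence: `log y ≤ y - 1` gives `y log y + 1 - y ≤
(y - 1)²`. -/
lemma klDiv_withDensity_le {Ω : Type*} [MeasurableSpace Ω] (P : Measure Ω) [IsProbabilityMeasure P]
    {w : Ω → ℝ} (hw : Measurable w) (hw1 : ∀ x, |w x| ≤ 1)
    [IsProbabilityMeasure (P.withDensity fun x => ENNReal.ofReal (1 + w x))] :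
    InformationTheory.klDiv (P.withDensity fun x => ENNReal.ofReal (1 + w x)) P ≤
      ENNReal.ofReal (∫ x, w x ^ 2 ∂P) := by
  have hi : Integrable (fun x => w x ^ 2) P := by
    refine Integrable.of_bound (C := 1) (by fun_prop) (Filter.Eventually.of_forall fun x => ?_)
    rw [Real.norm_eq_abs, abs_pow]
    exact pow_le_one₀ (abs_nonneg _) (hw1 x)
  rw [InformationTheory.klDiv_eq_lintegral_klFun_of_ac (withDensity_absolutelyContinuous _ _),
    ofReal_integral_eq_lintegral_ofReal hi (Filter.Eventually.of_forall fun x => sq_nonneg _)]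
  refine lintegral_mono_ae ?_
  filter_upwards [Measure.rnDeriv_withDensity P (f := fun x => ENNReal.ofReal (1 + w x))
    (by fun_prop)] with x hx
  have h0 : 0 ≤ 1 + w x := by have := abs_le.1 (hw1 x); linarith
  rw [hx, ENNReal.toReal_ofReal h0]
  apply ENNReal.ofReal_le_ofReal
  unfold InformationTheory.klFun
  rcases h0.eq_or_lt with h | h
  · rw [← h]
    have : w x = -1 := by linarith
    rw [this]; norm_num
  · have := Real.log_le_sub_one_of_pos h
    nlinarith

/-! ### The two-point bounds for the noise and variance terms -/

section Bounds

variable {X A : Type*} [MeasurableSpace X] [MeasurableSpace A]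

lemma gaussianInstance_mem {lam : Measure A} {g mu muStar sig del : X × A → ℝ} {ξ ξ' : Measure X}
    {K : Set (Kernel (X × A) ℝ)} {n : ℕ} (hmu : Measurable mu) (hsig : Measurable sig)
    (hK : ∀ (mu : X × A → ℝ) (hmu : Measurable mu), mu ∈ valueNbhd muStar del →
      gaussianOutcome mu sig hmu hsig ∈ K)
    (hξ : ξ' ∈ probNbhd n ξ) (hnb : mu ∈ valueNbhd muStar del)
    (hgmu : Integrable (fun p => g p * mu p) (ξ'.prod lam)) :
    gaussianInstance ξ' mu sig hmu hsig ∈ localClass n lam g K ξ muStar sig del :=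
  ⟨hξ, hnb, hgmu, hK _ hmu hnb, hasCondMoments_gaussianOutcome _ _ hmu hsig⟩

/-- The contribution of the outcome noise to the minimax risk. -/
lemma minimaxRisk_ge_noise (lam : Measure A) [SFinite lam]
    {pol g muStar sig del : X × A → ℝ} {ξ : Measure X} [IsProbabilityMeasure ξ]
    {K : Set (Kernel (X × A) ℝ)} {n : ℕ}
    (hpol : Measurable pol) (hg : Measurable g) (hmu : Measurable muStar)
    (hsig : Measurable sig) (hpol0 : ∀ p, 0 ≤ pol p)
    (hpol1 : ∀ s, ∫⁻ a, ENNReal.ofReal (pol (s, a)) ∂lam = 1)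
    (hgmu : Integrable (fun p => g p * muStar p) (ξ.prod lam))
    (hgsig : Integrable (fun p => g p ^ 2 / pol p * sig p ^ 2) (ξ.prod lam))
    (hK : ∀ (mu : X × A → ℝ) (hmu : Measurable mu), mu ∈ valueNbhd muStar del →
      gaussianOutcome mu sig hmu hsig ∈ K)
    (hdel0 : ∀ p, 0 ≤ del p)
    (hnb : ∀ p, |g p| * sig p ^ 2 / (pol p * weightedNorm lam pol g ξ sig) ≤ Real.sqrt n * del p)
    (hn : 1 ≤ n) :
    ENNReal.ofReal (1 / 16 * (weightedNormSq lam pol g ξ sig / n)) ≤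
      minimaxRisk n lam pol g (localClass n lam g K ξ muStar sig del) := by
  have hn' : (1 : ℝ) ≤ n := by exact_mod_cast hn
  set S := weightedNormSq lam pol g ξ sig with hS
  rcases le_or_gt S 0 with hS0 | hS0
  · rw [ENNReal.ofReal_of_nonpos]
    · exact bot_le
    · have : S / n ≤ 0 := div_nonpos_of_nonpos_of_nonneg hS0 (by linarith)
      linarith
  have := isProbabilityMeasure_stateActionLaw lam hpol hpol1 ξ
  have hSi : S = ∫ p, g p ^ 2 / pol p * sig p ^ 2 ∂(ξ.prod lam) :=
    weightedNormSq_eq_integral lam ξ hgsig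
  set N := weightedNorm lam pol g ξ sig with hN
  have hN0 : 0 < N := Real.sqrt_pos.2 hS0
  have hN2 : N ^ 2 = S := Real.sq_sqrt hS0.le
  have hq0 : 0 < √(n : ℝ) := Real.sqrt_pos.2 (by linarith)
  have hq2 : √(n : ℝ) ^ 2 = n := Real.sq_sqrt (by linarith)
  -- Normalized so that `E[θ² σ²] = 1/n`. The shift `θ σ²` then changes `τ` by `‖σ‖_ω / √n`.
  let θ : X × A → ℝ := fun p => g p / (√n * (pol p * N))
  have hθ : Measurable θ := by fun_prop
  let mu' : X × A → ℝ := fun p => muStar p + θ p * sig p ^ 2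
  have hmu' : Measurable mu' := by fun_prop
  have hnb' : mu' ∈ valueNbhd muStar del := by
    refine ⟨hmu', fun p => ?_⟩
    have e1 : mu' p - muStar p = g p * sig p ^ 2 / (pol p * N) / √n := by
      simp only [mu', θ]
      rw [div_div, mul_comm (pol p * N)]; ring
    rw [e1, abs_div, abs_of_pos hq0, div_le_iff₀ hq0, abs_div, abs_mul, abs_of_nonneg
      (sq_nonneg (sig p)), abs_of_nonneg (mul_nonneg (hpol0 p) hN0.le), mul_comm (del p)]
    exact hnb p
  have hstar : muStar ∈ valueNbhd muStar del := ⟨hmu, fun p => by simpa using hdel0 p⟩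
  have e2 : ∀ p, g p * mu' p =
      g p * muStar p + 1 / (√n * N) * (g p ^ 2 / pol p * sig p ^ 2) := by
    intro p
    simp only [mu', θ, div_eq_mul_inv, mul_inv]
    ring
  have hgmu' : Integrable (fun p => g p * mu' p) (ξ.prod lam) := by
    simp_rw [e2]
    exact hgmu.add (hgsig.const_mul _)
  have hgap : tau lam g ξ mu' - tau lam g ξ muStar = N / √n := by
    rw [tau_eq_integral lam ξ hgmu, tau_eq_integral lam ξ hgmu']
    simp_rw [e2]
    rw [integral_add hgmu (hgsig.const_mul _), integral_const_mul, ← hSi, ← hN2]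
    field_simp
    ring
  let f : (X × A) × ℝ → ℝ := fun d =>
    Real.exp (θ d.1 * (d.2 - muStar d.1) - θ d.1 ^ 2 * sig d.1 ^ 2 / 2)
  have hf : Measurable f := by fun_prop
  have hf0 : ∀ d, 0 ≤ f d := fun d => (Real.exp_pos _).le
  have hdens := sampleLaw_gaussianOutcome_shift lam pol ξ muStar sig θ mu' hmu hsig hθ hmu'
    fun _ => rfl
  let I₀ := gaussianInstance ξ muStar sig hmu hsig
  let I₁ := gaussianInstance ξ mu' sig hmu' hsig
  have m0 : I₀ ∈ localClass n lam g K ξ muStar sig del :=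
    gaussianInstance_mem hmu hsig hK (self_mem_probNbhd n ξ) hstar hgmu
  have m1 : I₁ ∈ localClass n lam g K ξ muStar sig del :=
    gaussianInstance_mem hmu' hsig hK (self_mem_probNbhd n ξ) hnb' hgmu'
  have i0 : IsProbabilityMeasure (sampleLaw lam pol I₀.stateLaw I₀.condLaw) :=
    isProbabilityMeasure_sampleLaw lam pol ξ (gaussianOutcome muStar sig hmu hsig)
  have i1 : IsProbabilityMeasure (sampleLaw lam pol I₁.stateLaw I₁.condLaw) :=
    isProbabilityMeasure_sampleLaw lam pol ξ (gaussianOutcome mu' sig hmu' hsig)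
  have key := minimaxRisk_ge_of_two_point n lam pol g _ I₀ I₁ m0 m1 f hf hf0 hdens
  refine le_trans (ENNReal.ofReal_le_ofReal ?_) key
  have hfi : Integrable f (sampleLaw lam pol I₀.stateLaw I₀.condLaw) := by
    refine ⟨hf.aestronglyMeasurable, ?_⟩
    rw [hasFiniteIntegral_iff_ofReal (Filter.Eventually.of_forall hf0)]
    have := i1.measure_univ
    change sampleLaw lam pol ξ (gaussianOutcome mu' sig hmu' hsig) Set.univ = 1 at this
    rw [hdens, withDensity_apply _ MeasurableSet.univ, setLIntegral_univ] at this
    exact this.trans_lt ENNReal.one_lt_top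
  have hpolθ : ∀ p, pol p * (θ p ^ 2 * sig p ^ 2) =
      1 / (n * S) * (g p ^ 2 / pol p * sig p ^ 2) := by
    intro p
    simp only [θ]
    rcases eq_or_ne (pol p) 0 with h | h
    · simp [h]
    · rw [div_pow, mul_pow, mul_pow, hq2, hN2]
      field_simp
  have hθi : Integrable (fun p => θ p ^ 2 * sig p ^ 2) (stateActionLaw lam pol ξ) := by
    rw [integrable_stateActionLaw_iff lam hpol hpol0]
    simp_rw [hpolθ]
    exact hgsig.const_mul _
  have hθI : ∫ p, θ p ^ 2 * sig p ^ 2 ∂(stateActionLaw lam pol ξ) = 1 / n := by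
    rw [integral_stateActionLaw lam hpol hpol0]
    simp_rw [hpolθ]
    rw [integral_const_mul, ← hSi]
    field_simp
  have haff : 1 - 1 / (2 * n : ℝ) ≤ ∫ x, √(f x) ∂(sampleLaw lam pol I₀.stateLaw I₀.condLaw) := by
    have e3 : ∫ x, √(f x) ∂(sampleLaw lam pol I₀.stateLaw I₀.condLaw) =
        ∫ p, Real.exp (-(θ p ^ 2 * sig p ^ 2 / 8)) ∂(stateActionLaw lam pol ξ) := by
      have := Measure.integral_compProd (μ := stateActionLaw lam pol ξ)
        (κ := gaussianOutcome muStar sig hmu hsig) (f := fun x => √(f x)) (integrable_sqrt hf0 hfi)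
      refine this.trans (integral_congr_ae (Filter.Eventually.of_forall fun p => ?_))
      have e4 := integral_sqrt_exp_gaussianReal (muStar p) (θ p) (Real.toNNReal (sig p ^ 2))
      rw [Real.coe_toNNReal _ (sq_nonneg _)] at e4
      exact e4
    rw [e3]
    have e5 : ∫ p, (1 - θ p ^ 2 * sig p ^ 2 / 8) ∂(stateActionLaw lam pol ξ) ≤
        ∫ p, Real.exp (-(θ p ^ 2 * sig p ^ 2 / 8)) ∂(stateActionLaw lam pol ξ) := by
      refine integral_mono ((integrable_const _).sub (hθi.div_const _)) ?_ fun p => ?_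
      · refine Integrable.of_bound (C := 1) (by fun_prop)
          (Filter.Eventually.of_forall fun p => ?_)
        rw [Real.norm_of_nonneg (Real.exp_pos _).le, Real.exp_le_one_iff]
        have : 0 ≤ θ p ^ 2 * sig p ^ 2 := by positivity
        linarith
      · have := Real.add_one_le_exp (-(θ p ^ 2 * sig p ^ 2 / 8))
        simp only
        linarith
    rw [integral_sub (integrable_const _) (hθi.div_const _), integral_div, hθI] at e5
    simp only [integral_const, probReal_univ, smul_eq_mul, mul_one] at e5
    have e6 : (1 : ℝ) / n / 8 ≤ 1 / (2 * n) := by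
      rw [div_div, div_le_div_iff₀ (by positivity) (by positivity)]; linarith
    linarith
  have hpow := half_le_pow_of_one_sub_le hn haff
  have hg2 : (tau lam g I₁.stateLaw I₁.outcome - tau lam g I₀.stateLaw I₀.outcome) ^ 2 = S / n := by
    change (tau lam g ξ mu' - tau lam g ξ muStar) ^ 2 = S / n
    rw [hgap, div_pow, hN2, hq2]
  rw [hg2]
  have h4 : (1 / 2 : ℝ) ^ 2 ≤
      ((∫ x, √(f x) ∂(sampleLaw lam pol I₀.stateLaw I₀.condLaw)) ^ n) ^ 2 :=
    pow_le_pow_left₀ (by norm_num) hpow 2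
  have h5 : 0 ≤ S / n := by positivity
  nlinarith

/-- The contribution of the variance of the conditional functional to the minimax risk. -/
lemma minimaxRisk_ge_variance (lam : Measure A) [SFinite lam]
    {pol g muStar sig del : X × A → ℝ} {ξ : Measure X} [IsProbabilityMeasure ξ]
    {K : Set (Kernel (X × A) ℝ)} {n : ℕ}
    (hpol : Measurable pol) (hg : Measurable g) (hmu : Measurable muStar)
    (hsig : Measurable sig)
    (hpol1 : ∀ s, ∫⁻ a, ENNReal.ofReal (pol (s, a)) ∂lam = 1)
    (hgmu : Integrable (fun p => g p * muStar p) (ξ.prod lam))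
    (hK : ∀ (mu : X × A → ℝ) (hmu : Measurable mu), mu ∈ valueNbhd muStar del →
      gaussianOutcome mu sig hmu hsig ∈ K)
    (hdel0 : ∀ p, 0 ≤ del p) (hZ4 : MemLp (centeredVar lam g ξ muStar) 4 ξ)
    (hn : 1 ≤ n) (hM : 8 * momentRatio ξ (centeredVar lam g ξ muStar) ^ 2 ≤ n) :
    ENNReal.ofReal (1 / 64 * (Var[actionInner lam g muStar; ξ] / n)) ≤
      minimaxRisk n lam pol g (localClass n lam g K ξ muStar sig del) := by
  have hn' : (1 : ℝ) ≤ n := by exact_mod_cast hn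
  set H := actionInner lam g muStar with hH
  have hHm : Measurable H :=
    (StronglyMeasurable.integral_prod_right' (hg.mul hmu).stronglyMeasurable).measurable
  have hHi : Integrable H ξ := hgmu.integral_prod_left
  have hτ : tau lam g ξ muStar = ∫ s, H s ∂ξ := tau_eq_integral_actionInner lam ξ hgmu
  set Z := centeredVar lam g ξ muStar with hZ
  have hZH : ∀ s, Z s = H s - ∫ s, H s ∂ξ := fun s => by
    rw [hZ, centeredVar, hτ, hH]
    simp only [actionInner, mul_comm]
  have hZm : Measurable Z := by
    have : Z = fun s => H s - ∫ s, H s ∂ξ := funext hZH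
    rw [this]; fun_prop
  have hV : Var[H; ξ] = ∫ s, Z s ^ 2 ∂ξ := by
    rw [variance_eq_integral hHm.aemeasurable]
    simp_rw [hZH]
  rw [hV]
  have hZ2 := integrable_sq_of_memLp hZ4
  set V := ∫ s, Z s ^ 2 ∂ξ with hVdef
  rcases le_or_gt V 0 with hV0 | hV0
  · rw [ENNReal.ofReal_of_nonpos]
    · exact bot_le
    · have : V / n ≤ 0 := div_nonpos_of_nonpos_of_nonneg hV0 (by linarith)
      linarith
  have hnV : 0 < n * V := by positivity
  -- Scale at which `t² E Z² = 1/n`, the radius of the relative entropy neighborhood.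
  set t := 1 / √(n * V) with ht
  have ht0 : 0 < t := by positivity
  have ht2 : t ^ 2 * (n * V) = 1 := by
    rw [ht, div_pow, Real.sq_sqrt hnV.le]; field_simp
  let k : X → ℝ := fun s => truncate t (Z s)
  have hkm : Measurable k := (measurable_truncate t).comp hZm
  have hkb : ∀ s, |t * k s| ≤ 1 / 2 := fun s => abs_mul_truncate_le t _
  have hkb' : ∀ s, |k s| ≤ 1 / 2 / t := fun s => by
    rw [le_div_iff₀ ht0]
    have := hkb s
    rwa [abs_mul, abs_of_pos ht0, mul_comm] at this
  have hki : Integrable k ξ :=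
    Integrable.of_bound hkm.aestronglyMeasurable _ (Filter.Eventually.of_forall hkb')
  set m := ∫ s, k s ∂ξ with hm
  have htm : |t * m| ≤ 1 / 2 := by
    rw [hm, ← integral_const_mul, ← Real.norm_eq_abs]
    have := norm_integral_le_of_norm_le_const (μ := ξ) (f := fun s => t * k s) (C := 1 / 2)
      (Filter.Eventually.of_forall hkb)
    simpa using this
  -- Centring gives the density `1 + w` total mass one; both `t k` and `t m` are at most `1/2` in
  -- absolute value, so it is nonnegative.
  let w : X → ℝ := fun s => t * (k s - m)
  have hwm : Measurable w := by fun_prop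
  have hwb : ∀ s, |w s| ≤ 1 := fun s => by
    have : w s = t * k s - t * m := by simp only [w]; ring
    rw [this]
    exact (abs_sub _ _).trans (by linarith [hkb s])
  have hwi : Integrable w ξ := (hki.sub (integrable_const _)).const_mul _
  have hw0 : ∫ s, w s ∂ξ = 0 := by
    simp only [w]
    rw [integral_const_mul, integral_sub hki (integrable_const _)]
    simp [← hm]
  have hw1 : ∀ s, 0 ≤ 1 + w s := fun s => by have := abs_le.1 (hwb s); linarith
  have hw2i : Integrable (fun s => w s ^ 2) ξ := by
    refine Integrable.of_bound (C := 1) (by fun_prop) (Filter.Eventually.of_forall fun x => ?_)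
    rw [Real.norm_eq_abs, abs_pow]
    exact pow_le_one₀ (abs_nonneg _) (hwb x)
  have hk2i : Integrable (fun s => k s ^ 2) ξ :=
    hZ2.mono' (by fun_prop) (Filter.Eventually.of_forall fun s => by
      rw [Real.norm_of_nonneg (sq_nonneg _)]; exact truncate_sq_le t _)
  -- Neither truncating nor centring increases the second moment, so the bound is `t² V`.
  have hw2 : ∫ s, w s ^ 2 ∂ξ ≤ 1 / n := by
    have e1 : ∀ s, w s ^ 2 = t ^ 2 * k s ^ 2 - 2 * t ^ 2 * m * k s + t ^ 2 * m ^ 2 := fun s => by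
      simp only [w]; ring
    have e2 : ∫ s, w s ^ 2 ∂ξ = t ^ 2 * ∫ s, k s ^ 2 ∂ξ - t ^ 2 * m ^ 2 := by
      simp_rw [e1]
      have i1 : Integrable (fun s => t ^ 2 * k s ^ 2 - 2 * t ^ 2 * m * k s) ξ :=
        (hk2i.const_mul _).sub (hki.const_mul _)
      rw [integral_add i1 (integrable_const _),
        integral_sub (hk2i.const_mul _) (hki.const_mul _), integral_const_mul,
        integral_const_mul, ← hm]
      simp only [integral_const, probReal_univ, smul_eq_mul]
      ring
    have e3 : ∫ s, k s ^ 2 ∂ξ ≤ V := integral_mono hk2i hZ2 fun s => truncate_sq_le t _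
    have e4 : t ^ 2 * V = 1 / n := by
      rw [eq_div_iff (by positivity)]; linarith
    have e5 : 0 ≤ t ^ 2 * m ^ 2 := by positivity
    nlinarith [mul_le_mul_of_nonneg_left e3 (sq_nonneg t)]
  set ξ' := ξ.withDensity fun s => ENNReal.ofReal (1 + w s) with hξ'
  have h1wi : Integrable (fun s => 1 + w s) ξ := (integrable_const _).add hwi
  have hξ'p : IsProbabilityMeasure ξ' := by
    refine ⟨?_⟩
    rw [hξ', withDensity_apply _ MeasurableSet.univ, setLIntegral_univ,
      ← ofReal_integral_eq_lintegral_ofReal h1wi (Filter.Eventually.of_forall hw1),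
      integral_add (integrable_const _) hwi, hw0]
    simp
  have hξ'n : ξ' ∈ probNbhd n ξ := by
    refine ⟨hξ'p, (klDiv_withDensity_le ξ hwm hwb).trans ?_⟩
    refine (ENNReal.ofReal_le_ofReal hw2).trans (le_of_eq ?_)
    rw [one_div, ENNReal.ofReal_inv_of_pos (by linarith), ENNReal.ofReal_natCast]
  have hprod : ξ'.prod lam = (ξ.prod lam).withDensity fun p => ENNReal.ofReal (1 + w p.1) :=
    prod_withDensity_left (by fun_prop)
  have hgmu' : Integrable (fun p => g p * muStar p) (ξ'.prod lam) := by
    rw [hprod, integrable_withDensity_iff_integrable_smul' (by fun_prop)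
      (Filter.Eventually.of_forall fun _ => ENNReal.ofReal_lt_top)]
    simp_rw [ENNReal.toReal_ofReal (hw1 _)]
    simp_rw [smul_eq_mul]
    refine hgmu.bdd_mul (c := 2)
      (measurable_const.add (hwm.comp measurable_fst)).aestronglyMeasurable (Filter.Eventually.of_forall fun p => ?_)
    have := abs_le.1 (hwb p.1)
    rw [Real.norm_of_nonneg (hw1 _)]; linarith
  have hHwi : Integrable (fun s => w s * H s) ξ :=
    hHi.bdd_mul (c := 1) hwm.aestronglyMeasurable (Filter.Eventually.of_forall hwb)
  have hHki : Integrable (fun s => k s * H s) ξ :=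
    hHi.bdd_mul hkm.aestronglyMeasurable (Filter.Eventually.of_forall hkb')
  have hZki : Integrable (fun s => Z s * k s) ξ := by
    simp_rw [hZH, sub_mul]
    refine Integrable.sub ?_ (hki.const_mul _)
    simpa only [mul_comm] using hHki
  have hτ' : tau lam g ξ' muStar = ∫ s, H s ∂ξ + t * ∫ s, Z s * k s ∂ξ := by
    rw [tau_eq_integral_actionInner lam ξ' hgmu', hξ',
      integral_withDensity_eq_integral_toReal_smul (by fun_prop)
        (Filter.Eventually.of_forall fun _ => ENNReal.ofReal_lt_top)]
    simp_rw [ENNReal.toReal_ofReal (hw1 _), smul_eq_mul, add_mul, one_mul]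
    rw [integral_add hHi hHwi]
    congr 1
    have e1 : ∀ s, w s * H s = t * (k s * H s) - t * m * H s := fun s => by
      simp only [w]; ring
    have e2 : ∀ s, Z s * k s = k s * H s - (∫ s, H s ∂ξ) * k s := fun s => by rw [hZH]; ring
    simp_rw [e1, e2]
    rw [integral_sub (hHki.const_mul _) (hHi.const_mul _),
      integral_sub hHki (hki.const_mul _), integral_const_mul, integral_const_mul,
      integral_const_mul, ← hm]
    ring
  have hgap : t * (7 / 8 * V) ≤ tau lam g ξ' muStar - tau lam g ξ muStar := by
    rw [hτ', hτ, add_sub_cancel_left]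
    exact mul_le_mul_of_nonneg_left (integral_mul_truncate_ge hZ4 hV0 hM ht2 hZki) ht0.le
  have hstar : muStar ∈ valueNbhd muStar del := ⟨hmu, fun p => by simpa using hdel0 p⟩
  have := isProbabilityMeasure_stateActionLaw lam hpol hpol1 ξ
  have := isProbabilityMeasure_stateActionLaw lam hpol hpol1 ξ'
  let κ := gaussianOutcome muStar sig hmu hsig
  let I₀ := gaussianInstance ξ muStar sig hmu hsig
  let I₁ := gaussianInstance ξ' muStar sig hmu hsig
  have m0 : I₀ ∈ localClass n lam g K ξ muStar sig del :=
    gaussianInstance_mem hmu hsig hK (self_mem_probNbhd n ξ) hstar hgmu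
  have m1 : I₁ ∈ localClass n lam g K ξ muStar sig del :=
    gaussianInstance_mem hmu hsig hK hξ'n hstar hgmu'
  have i0 : IsProbabilityMeasure (sampleLaw lam pol I₀.stateLaw I₀.condLaw) :=
    isProbabilityMeasure_sampleLaw lam pol ξ κ
  have i1 : IsProbabilityMeasure (sampleLaw lam pol I₁.stateLaw I₁.condLaw) :=
    isProbabilityMeasure_sampleLaw lam pol ξ' κ
  have hdens := sampleLaw_withDensity lam hpol ξ κ (r := fun s => 1 + w s) (by fun_prop)
  have key := minimaxRisk_ge_of_two_point n lam pol g _ I₀ I₁ m0 m1 (fun d => 1 + w d.1.1)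
    (by fun_prop) (fun _ => hw1 _) hdens
  refine le_trans (ENNReal.ofReal_le_ofReal ?_) key
  have haff : 1 - 1 / (2 * n : ℝ) ≤
      ∫ x, √(1 + w x.1.1) ∂(sampleLaw lam pol I₀.stateLaw I₀.condLaw) := by
    have e1 : ∫ x, √(1 + w x.1.1) ∂(sampleLaw lam pol ξ κ) = ∫ s, √(1 + w s) ∂ξ :=
      (integral_sampleLaw_comp_fst lam pol ξ κ (F := fun p => √(1 + w p.1)) (by fun_prop)).trans
        (integral_stateActionLaw_comp_fst lam hpol hpol1 ξ (F := fun s => √(1 + w s))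
          (by fun_prop))
    refine le_of_le_of_eq ?_ e1.symm
    have e2 : ∫ s, (1 + w s / 2 - w s ^ 2 / 2) ∂ξ ≤ ∫ s, √(1 + w s) ∂ξ :=
      integral_mono (((integrable_const _).add (hwi.div_const _)).sub (hw2i.div_const _))
        (integrable_sqrt hw1 h1wi)
        fun s => one_add_sub_sq_le_sqrt (abs_le.1 (hwb s)).1 (abs_le.1 (hwb s)).2
    have i2 : Integrable (fun s => 1 + w s / 2) ξ := (integrable_const _).add (hwi.div_const _)
    rw [integral_sub i2 (hw2i.div_const _), integral_add (integrable_const _) (hwi.div_const _), integral_div, integral_div, hw0] at e2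
    simp only [integral_const, probReal_univ, smul_eq_mul, mul_one] at e2
    have e3 : (1 : ℝ) / (2 * n) = 1 / n / 2 := by rw [div_div, mul_comm]
    linarith
  have hpow := half_le_pow_of_one_sub_le hn haff
  -- The truncation factor gives `(7/8)² = 49/64`, weakened to `1/4`.
  have hg2 : (1 / 4 : ℝ) * (V / n) ≤
      (tau lam g I₁.stateLaw I₁.outcome - tau lam g I₀.stateLaw I₀.outcome) ^ 2 := by
    change _ ≤ (tau lam g ξ' muStar - tau lam g ξ muStar) ^ 2
    have e1 := pow_le_pow_left₀ (by positivity) hgap 2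
    have e2 : (t * (7 / 8 * V)) ^ 2 = 49 / 64 * (V / n) := by
      have : t ^ 2 * V = 1 / n := by rw [eq_div_iff (by positivity)]; linarith
      calc _ = 49 / 64 * ((t ^ 2 * V) * V) := by ring
        _ = _ := by rw [this]; ring
    have e3 : 0 ≤ V / n := by positivity
    linarith
  have h4 : (1 / 2 : ℝ) ^ 2 ≤
      ((∫ x, √(1 + w x.1.1) ∂(sampleLaw lam pol I₀.stateLaw I₀.condLaw)) ^ n) ^ 2 :=
    pow_le_pow_left₀ (by norm_num) hpow 2
  have h5 : 0 ≤ V / n := by positivity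
  calc 1 / 64 * (V / n) = 1 / 4 * (V / n) / 4 * (1 / 2) ^ 2 := by ring
    _ ≤ _ := by gcongr

end Bounds

/-! ### Random signs on a finite partition into cells -/

section RandomSigns

variable {J : Type*}

/-- The weight `∏ (1 - u²)` over a sample of cells is at most the affinity over the visited
cells; a visited cell `c` gets no weight. -/
lemma sum_unvisited_le [Fintype J] [DecidableEq J] {n : ℕ} (z : Fin n → J) (u h : J → ℝ) (hu0 : ∀ c, 0 ≤ u c)
    (hu1 : ∀ c, u c ≤ 1) (hh : ∀ c, 0 ≤ h c) :
    ∑ c, h c * u c * ∏ k, (if z k = c then 0 else 1 - u (z k) ^ 2) ≤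
      (∏ c ∈ Finset.univ.image z, √(1 - u c ^ 2)) *
        ∑ c ∈ (Finset.univ.image z)ᶜ, h c * u c := by
  have hv : ∀ c, 0 ≤ 1 - u c ^ 2 := fun c => by nlinarith [hu0 c, hu1 c]
  have hv1 : ∀ c, 1 - u c ^ 2 ≤ 1 := fun c => by nlinarith [sq_nonneg (u c)]
  rw [← Finset.sum_subset (Finset.subset_univ (Finset.univ.image z)ᶜ), Finset.mul_sum]
  · refine Finset.sum_le_sum fun c hc => ?_
    rw [mul_comm (∏ c ∈ _, _)]
    refine mul_le_mul_of_nonneg_left ?_ (mul_nonneg (hh c) (hu0 c))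
    have hc' : ∀ k, z k ≠ c := by simpa using hc
    have h1 : ∏ k, (if z k = c then 0 else 1 - u (z k) ^ 2) = ∏ k, (1 - u (z k) ^ 2) :=
      Finset.prod_congr rfl fun k _ => if_neg (hc' k)
    rw [h1, Finset.prod_comp (fun c => 1 - u c ^ 2) z]
    refine Finset.prod_le_prod (fun c _ => pow_nonneg (hv c) _) fun c hc => ?_
    -- A visited cell occurs with multiplicity at least one, and for `x = 1 - u²` in `[0, 1]` every
    -- positive power of `x` is at most `x ≤ √x`. The cruder product over sample points factorizes
    -- under i.i.d. sampling.
    have h2 : (Finset.univ.filter fun k => z k = c).card ≠ 0 := by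
      obtain ⟨k, _, hk⟩ := Finset.mem_image.1 hc
      exact Finset.card_ne_zero.2 ⟨k, by simpa using hk⟩
    refine (pow_le_of_le_one (hv c) (hv1 c) h2).trans ?_
    apply Real.le_sqrt_of_sq_le
    exact pow_le_of_le_one (hv c) (hv1 c) two_ne_zero
  · intro c _ hc
    have hc' : ∃ k, z k = c := by simpa using hc
    obtain ⟨k, hk⟩ := hc'
    have h0 : ∏ k, (if z k = c then 0 else 1 - u (z k) ^ 2) = 0 :=
      Finset.prod_eq_zero (Finset.mem_univ k) (if_pos hk)
    rw [h0, mul_zero]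

variable {X A : Type*}

/-- The sign of `x`, with value `1` at `0`. -/
def unitSign (x : ℝ) : ℝ := if 0 ≤ x then 1 else -1

lemma measurable_unitSign : Measurable unitSign :=
  Measurable.ite measurableSet_Ici measurable_const measurable_const

lemma mul_unitSign (x : ℝ) : x * unitSign x = |x| := by
  unfold unitSign
  split_ifs with h
  · rw [abs_of_nonneg h, mul_one]
  · rw [abs_of_neg (not_le.1 h)]; ring

lemma abs_unitSign (x : ℝ) : |unitSign x| = 1 := by
  unfold unitSign; split_ifs <;> simp

/-- The outcome function at the boundary of the band, on the side given by the sign of the cell. -/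
def signedOutcome (muStar g del : X × A → ℝ) (C : X × A → J) (ε : J → Bool) (p : X × A) : ℝ :=
  muStar p + boolSign (ε (C p)) * unitSign (g p) * del p

lemma signedOutcome_congr (muStar g del : X × A → ℝ) (C : X × A → J) {ε ε' : J → Bool}
    {p : X × A} (h : ε (C p) = ε' (C p)) :
    signedOutcome muStar g del C ε p = signedOutcome muStar g del C ε' p := by
  simp [signedOutcome, h]

lemma pol_mul_abs_perturbVar {pol g del : X × A → ℝ} (hpol0 : ∀ p, 0 ≤ pol p)
    (hgpol : ∀ p, pol p = 0 → g p = 0) (hdel0 : ∀ p, 0 ≤ del p) (p : X × A) :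
    pol p * |perturbVar pol g del p| = |g p| * del p := by
  rw [perturbVar, abs_div, abs_mul, abs_of_nonneg (hpol0 p), abs_of_nonneg (hdel0 p)]
  rcases eq_or_ne (pol p) 0 with h | h
  · simp [h, hgpol p h]
  · field_simp

/-- The factor `unitSign (g p)` aligns the perturbation with `g`, so that every positive sign raises
`τ`; a cell then contributes its sign times the integral of `|Z|` over it. -/
lemma mul_signedOutcome {pol muStar g del : X × A → ℝ} (C : X × A → J)
    (hpol0 : ∀ p, 0 ≤ pol p) (hgpol : ∀ p, pol p = 0 → g p = 0) (hdel0 : ∀ p, 0 ≤ del p)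
    (ε : J → Bool) (p : X × A) :
    g p * signedOutcome muStar g del C ε p =
      g p * muStar p + pol p * (boolSign (ε (C p)) * |perturbVar pol g del p|) := by
  rw [mul_left_comm (pol p), pol_mul_abs_perturbVar hpol0 hgpol hdel0, signedOutcome,
    ← mul_unitSign]
  ring

lemma mul_eq_sum_indicator [Fintype J] (C : X × A → J) (W : X × A → ℝ) (b : J → ℝ) (p : X × A) :
    b (C p) * W p = ∑ c, (C ⁻¹' {c}).indicator W p * b c := by
  rw [Finset.sum_eq_single (C p)]
  · simp [mul_comm]
  · intro c _ hc
    rw [Set.indicator_of_notMem (fun h => hc h.symm), zero_mul]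
  · simp

variable [MeasurableSpace X] [MeasurableSpace A] [MeasurableSpace J]
  [DiscreteMeasurableSpace J] [Fintype J]

lemma measurable_signedOutcome {muStar g del : X × A → ℝ} {C : X × A → J}
    (hmu : Measurable muStar) (hg : Measurable g) (hdel : Measurable del) (hC : Measurable C)
    (ε : J → Bool) : Measurable (signedOutcome muStar g del C ε) := by
  have h1 : Measurable fun p => boolSign (ε (C p)) :=
    (measurable_of_countable fun c => boolSign (ε c)).comp hC
  exact hmu.add ((h1.mul (measurable_unitSign.comp hg)).mul hdel)

lemma signedOutcome_mem_valueNbhd {muStar g del : X × A → ℝ} {C : X × A → J}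
    (hmu : Measurable muStar) (hg : Measurable g) (hdel : Measurable del) (hC : Measurable C)
    (hdel0 : ∀ p, 0 ≤ del p) (ε : J → Bool) :
    signedOutcome muStar g del C ε ∈ valueNbhd muStar del := by
  refine ⟨measurable_signedOutcome hmu hg hdel hC ε, fun p => ?_⟩
  rw [signedOutcome, add_sub_cancel_left, abs_mul, abs_mul, abs_boolSign, abs_unitSign, one_mul,
    one_mul, abs_of_nonneg (hdel0 p)]

lemma integrable_comp_cell_mul {P : Measure (X × A)} {C : X × A → J} (hC : Measurable C)
    {W : X × A → ℝ} (hW : Integrable W P) (b : J → ℝ) : Integrable (fun p => b (C p) * W p) P := by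
  simp_rw [mul_eq_sum_indicator C W b]
  exact integrable_finsetSum _ fun c _ =>
    (hW.indicator (hC MeasurableSet.of_discrete)).mul_const _

lemma integral_comp_cell_mul {P : Measure (X × A)} {C : X × A → J} (hC : Measurable C)
    {W : X × A → ℝ} (hW : Integrable W P) (b : J → ℝ) :
    ∫ p, b (C p) * W p ∂P = ∑ c, (∫ p in C ⁻¹' {c}, W p ∂P) * b c := by
  have hm : ∀ c, MeasurableSet (C ⁻¹' {c}) := fun c => hC MeasurableSet.of_discrete
  simp_rw [mul_eq_sum_indicator C W b]
  rw [integral_finsetSum _ fun c _ => (hW.indicator (hm c)).mul_const _]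
  refine Finset.sum_congr rfl fun c _ => ?_
  rw [integral_mul_const, integral_indicator (hm c)]

/-- The Bayes bound for a prior of random signs on a finite measurable partition into cells. -/
lemma minimaxRisk_ge_of_cells [DecidableEq J] (lam : Measure A) [SFinite lam]
    {pol g muStar sig del : X × A → ℝ} {ξ : Measure X} [IsProbabilityMeasure ξ]
    {K : Set (Kernel (X × A) ℝ)} {n : ℕ}
    (hpol : Measurable pol) (hg : Measurable g) (hmu : Measurable muStar)
    (hsig : Measurable sig) (hdel : Measurable del) (hpol0 : ∀ p, 0 ≤ pol p)
    (hpol1 : ∀ s, ∫⁻ a, ENNReal.ofReal (pol (s, a)) ∂lam = 1)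
    (hgpol : ∀ p, pol p = 0 → g p = 0)
    (hgmu : Integrable (fun p => g p * muStar p) (ξ.prod lam))
    (hK : ∀ (mu : X × A → ℝ) (hmu : Measurable mu), mu ∈ valueNbhd muStar del →
      gaussianOutcome mu sig hmu hsig ∈ K)
    (hdel0 : ∀ p, 0 ≤ del p)
    (hZ : Integrable (perturbVar pol g del) (stateActionLaw lam pol ξ))
    (C : X × A → J) (hC : Measurable C) (u : J → ℝ) (hu0 : ∀ c, 0 ≤ u c) (hu1 : ∀ c, u c ≤ 1) :
    ENNReal.ofReal ((∑ c,
      (∫ p in C ⁻¹' {c}, |perturbVar pol g del p| ∂(stateActionLaw lam pol ξ)) * u c *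
        (∫ p, (if C p = c then 0 else 1 - u (C p) ^ 2) ∂(stateActionLaw lam pol ξ)) ^ n) ^ 2) ≤
      minimaxRisk n lam pol g (localClass n lam g K ξ muStar sig del) := by
  have hPp := isProbabilityMeasure_stateActionLaw lam hpol hpol1 ξ
  set P := stateActionLaw lam pol ξ with hP
  set Z := perturbVar pol g del with hZdef
  have hZa : Integrable (fun p => |Z p|) P := hZ.abs
  set h : J → ℝ := fun c => ∫ p in C ⁻¹' {c}, |Z p| ∂P with hh
  have hh0 : ∀ c, 0 ≤ h c := fun c => integral_nonneg fun p => abs_nonneg _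
  -- One factor per sample point encodes both that `c` is unvisited and the affinity loss, so the
  -- expectation over the sample is an `n`-th power.
  let φ : J → X × A → ℝ := fun c p => if C p = c then 0 else 1 - u (C p) ^ 2
  have hφm : ∀ c, Measurable (φ c) := fun c =>
    (measurable_of_countable fun j => if j = c then (0 : ℝ) else 1 - u j ^ 2).comp hC
  have hφb : ∀ c p, ‖φ c p‖ ≤ 1 := fun c p => by
    simp only [φ]
    split_ifs
    · simp
    · rw [Real.norm_eq_abs, abs_le]
      constructor <;> nlinarith [hu0 (C p), hu1 (C p)]
  set Λ := ∑ c, h c * u c * (∫ p, φ c p ∂P) ^ n with hΛ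
  change ENNReal.ofReal (Λ ^ 2) ≤ _
  let mu := signedOutcome muStar g del C
  have hmum : ∀ ε, Measurable (mu ε) := measurable_signedOutcome hmu hg hdel hC
  have hgmuε : ∀ ε, Integrable (fun p => g p * mu ε p) (ξ.prod lam) := fun ε => by
    simp_rw [mu, mul_signedOutcome C hpol0 hgpol hdel0 ε]
    exact hgmu.add ((integrable_stateActionLaw_iff lam hpol hpol0 ξ _).1
      (integrable_comp_cell_mul hC hZa fun c => boolSign (ε c)))
  have hτ : ∀ ε, tau lam g ξ (mu ε) = tau lam g ξ muStar + ∑ c, h c * boolSign (ε c) := fun ε => by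
    rw [tau_eq_integral lam ξ (hgmuε ε), tau_eq_integral lam ξ hgmu]
    simp_rw [mu, mul_signedOutcome C hpol0 hgpol hdel0 ε]
    rw [integral_add hgmu ((integrable_stateActionLaw_iff lam hpol hpol0 ξ _).1
      (integrable_comp_cell_mul hC hZa fun c => boolSign (ε c))), ← integral_stateActionLaw lam hpol hpol0,
      integral_comp_cell_mul hC hZa fun c => boolSign (ε c)]
  have hmem : ∀ ε, gaussianInstance ξ (mu ε) sig (hmum ε) hsig ∈
      localClass n lam g K ξ muStar sig del := fun ε =>
    gaussianInstance_mem (hmum ε) hsig hK (self_mem_probNbhd n ξ)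
      (signedOutcome_mem_valueNbhd hmu hg hdel hC hdel0 ε) (hgmuε ε)
  refine le_iInf fun est => ?_
  set M := ⨆ I ∈ localClass n lam g K ξ muStar sig del, mse n lam pol g est.1 I with hM
  set Q := P.prod (gaussianReal 0 1) with hQ
  set Qn := Measure.pi fun _ : Fin n => Q with hQn
  -- Coupling: state, action and standard noise are drawn from the same `Q` for every `ε`. Given
  -- them, the data are a deterministic function of the signs of the visited cells.
  let dat : (J → Bool) → (Fin n → (X × A) × ℝ) → Fin n → (X × A) × ℝ := fun ε ω k =>
    ((ω k).1, sig (ω k).1 * (ω k).2 + mu ε (ω k).1)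
  have hone : ∀ ε, Measurable fun q : (X × A) × ℝ => (q.1, sig q.1 * q.2 + mu ε q.1) := fun ε => by
    have := hmum ε
    fun_prop
  have hdat : ∀ ε, Measurable (dat ε) := fun ε =>
    measurable_pi_lambda _ fun k => (hone ε).comp (measurable_pi_apply k)
  have hmse : ∀ ε, ∫⁻ ω, ENNReal.ofReal ((tau lam g ξ muStar + ∑ c, h c * boolSign (ε c) -
      est.1 (dat ε ω)) ^ 2) ∂Qn ≤ M := fun ε => by
    have e1 : mse n lam pol g est.1 (gaussianInstance ξ (mu ε) sig (hmum ε) hsig) ≤ M :=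
      le_iSup₂_of_le (f := fun I _ => mse n lam pol g est.1 I) _ (hmem ε) le_rfl
    refine le_of_eq_of_le ?_ e1
    have e2 : (Measure.pi fun _ : Fin n =>
        sampleLaw lam pol ξ (gaussianOutcome (mu ε) sig (hmum ε) hsig)) = Qn.map (dat ε) := by
      rw [sampleLaw_gaussianOutcome_eq_map]
      have := Measure.isProbabilityMeasure_map (μ := Q) (hone ε).aemeasurable
      rw [hQn, ← Measure.pi_map_pi fun _ => (hone ε).aemeasurable]
    change _ = ∫⁻ d, ENNReal.ofReal (|tau lam g ξ (mu ε) - est.1 d| ^ 2) ∂(Measure.pi fun _ : Fin n =>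
        sampleLaw lam pol ξ (gaussianOutcome (mu ε) sig (hmum ε) hsig))
    have hest := est.2
    rw [e2, lintegral_map (by fun_prop) (hdat ε), hτ]
    simp_rw [sq_abs]
  -- The prior: an even mixture of the product laws with means `u` and `-u`.
  let w : (J → Bool) → ℝ := fun ε => (signsWeight u ε + signsWeight (-u) ε) / 2
  have hua : ∀ c, |u c| ≤ 1 := fun c => by rw [abs_of_nonneg (hu0 c)]; exact hu1 c
  have hw0 : ∀ ε, 0 ≤ w ε := fun ε => by
    have e1 := signsWeight_nonneg hua ε
    have e2 := signsWeight_nonneg (u := -u) (fun c => by simpa using hua c) ε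
    simp only [w]; linarith
  have hw1 : ∑ ε, ENNReal.ofReal (w ε) = 1 := by
    rw [← ENNReal.ofReal_sum_of_nonneg fun ε _ => hw0 ε]
    simp only [w]
    rw [← Finset.sum_div, Finset.sum_add_distrib, sum_signsWeight, sum_signsWeight]
    norm_num
  let Ψ : (Fin n → (X × A) × ℝ) → ℝ := fun ω => ∑ c, h c * u c * ∏ k, φ c (ω k).1
  have hφi : ∀ c, Integrable (fun q : (X × A) × ℝ => φ c q.1) Q := fun c =>
    Integrable.of_bound (C := 1) ((hφm c).comp measurable_fst).aestronglyMeasurable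
      (Filter.Eventually.of_forall fun q => hφb c q.1)
  have hprodi : ∀ c, Integrable (fun ω : Fin n → (X × A) × ℝ => ∏ k, φ c (ω k).1) Qn := fun c =>
    Integrable.fintype_prod (f := fun _ (q : (X × A) × ℝ) => φ c q.1) fun _ => hφi c
  have hΨi : Integrable Ψ Qn := integrable_finsetSum _ fun c _ => (hprodi c).const_mul _
  have hΨI : ∫ ω, Ψ ω ∂Qn = Λ := by
    simp only [Ψ]
    rw [integral_finsetSum _ fun c _ => (hprodi c).const_mul _]
    refine Finset.sum_congr rfl fun c _ => ?_
    rw [integral_const_mul, integral_fintype_prod_eq_pow (fun q : (X × A) × ℝ => φ c q.1),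
      Fintype.card_fin, hQ, integral_fun_fst]
    simp
  have hφ0 : ∀ c p, 0 ≤ φ c p := fun c p => by
    simp only [φ]
    split_ifs
    · exact le_rfl
    · nlinarith [hu0 (C p), hu1 (C p)]
  have hΨ0 : ∀ ω, 0 ≤ Ψ ω := fun ω => Finset.sum_nonneg fun c _ =>
    mul_nonneg (mul_nonneg (hh0 c) (hu0 c)) (Finset.prod_nonneg fun k _ => hφ0 c _)
  have hΛ0 : 0 ≤ Λ := hΨI ▸ integral_nonneg hΨ0
  -- The multiplier `l` is the constant `Λ = E Ψ`, the same for all `ω`; after integration the bound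
  -- reads `2 Λ² ≤ M + Λ²`.
  have pw : ∀ ω, ENNReal.ofReal (2 * Λ * Ψ ω) ≤
      ∑ ε, ENNReal.ofReal (w ε) * ENNReal.ofReal ((tau lam g ξ muStar +
        ∑ c, h c * boolSign (ε c) - est.1 (dat ε ω)) ^ 2) + ENNReal.ofReal (Λ ^ 2) := by
    intro ω
    have e1 := bayesRisk_signs u h hua (Finset.univ.image fun k => C (ω k).1)
      (fun ε => est.1 (dat ε ω)) (fun ε ε' he => by
        have : dat ε ω = dat ε' ω := by
          funext k
          simp only [dat, mu]
          rw [signedOutcome_congr muStar g del C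
            (he _ (Finset.mem_image_of_mem _ (Finset.mem_univ k)))]
        simp only [this]) (tau lam g ξ muStar) Λ
    have e2 : Ψ ω ≤ _ := sum_unvisited_le (fun k => C (ω k).1) u h hu0 hu1 hh0
    have e3 := mul_le_mul_of_nonneg_left e2 (mul_nonneg zero_le_two hΛ0)
    simp_rw [← ENNReal.ofReal_mul (hw0 _)]
    rw [← ENNReal.ofReal_sum_of_nonneg fun ε _ => mul_nonneg (hw0 ε) (sq_nonneg _),
      ← ENNReal.ofReal_add (Finset.sum_nonneg fun ε _ => mul_nonneg (hw0 ε) (sq_nonneg _))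
        (sq_nonneg _)]
    exact ENNReal.ofReal_le_ofReal (e3.trans e1)
  have tot := lintegral_mono (μ := Qn) pw
  have hestm : ∀ ε, Measurable fun ω => ENNReal.ofReal ((tau lam g ξ muStar +
      ∑ c, h c * boolSign (ε c) - est.1 (dat ε ω)) ^ 2) := fun ε => by
    have := est.2.comp (hdat ε)
    exact ((measurable_const.sub this).pow_const 2).ennreal_ofReal
  rw [lintegral_add_right _ measurable_const,
    lintegral_finsetSum _ fun ε _ => (hestm ε).const_mul _,
    ← ofReal_integral_eq_lintegral_ofReal (hΨi.const_mul _) (Filter.Eventually.of_forall fun ω =>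
      mul_nonneg (mul_nonneg zero_le_two hΛ0) (hΨ0 ω)),
    integral_const_mul, hΨI, lintegral_const, measure_univ, mul_one] at tot
  have tot2 : ENNReal.ofReal (2 * Λ * Λ) ≤ M + ENNReal.ofReal (Λ ^ 2) := by
    refine tot.trans (add_le_add ?_ le_rfl)
    calc _ ≤ ∑ ε, ENNReal.ofReal (w ε) * M := by
          refine Finset.sum_le_sum fun ε _ => ?_
          rw [lintegral_const_mul _ (hestm ε)]
          exact mul_le_mul_right (hmse ε) _
      _ = M := by rw [← Finset.sum_mul, hw1, one_mul]
  have e4 : 2 * Λ * Λ = Λ ^ 2 + Λ ^ 2 := by ring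
  rw [e4, ENNReal.ofReal_add (sq_nonneg _) (sq_nonneg _)] at tot2
  exact (ENNReal.add_le_add_iff_right ENNReal.ofReal_ne_top).1 tot2

end RandomSigns

/-! ### The bound for the band: choice of cells and of sign means -/

section Band

variable {X A : Type*} [MeasurableSpace X] [MeasurableSpace A]

/-- The sets of states sharing the first `d` bits of `s` decrease to `{s}` by injectivity, and
finite measures are continuous from above. -/
lemma tendsto_measureReal_fiber (ξ : Measure X) [IsFiniteMeasure ξ] {f : X → ℕ → Bool}
    (hf : Measurable f) (hfi : Function.Injective f) (s : X) :
    Filter.Tendsto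
      (fun d : ℕ => ξ.real ((fun x (i : Fin d) => f x i) ⁻¹' {fun i : Fin d => f s i}))
      Filter.atTop (nhds (ξ.real {s})) := by
  have hset : ∀ d : ℕ, (fun x (i : Fin d) => f x i) ⁻¹' {fun i : Fin d => f s i} =
      {x | ∀ i < d, f x i = f s i} := by
    intro d
    ext x
    simp only [Set.mem_preimage, Set.mem_singleton_iff, Set.mem_ofPred_eq, funext_iff]
    exact ⟨fun h i hi => h ⟨i, hi⟩, fun h i => h i i.2⟩
  have hm : ∀ d : ℕ, MeasurableSet ((fun x (i : Fin d) => f x i) ⁻¹' {fun i : Fin d => f s i}) :=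
    fun d => (measurable_pi_lambda _ fun i : Fin d => (measurable_pi_apply (i : ℕ)).comp hf)
      MeasurableSet.of_discrete
  have hI : ⋂ d : ℕ, (fun x (i : Fin d) => f x i) ⁻¹' {fun i : Fin d => f s i} = {s} := by
    ext x
    simp only [hset, Set.mem_iInter, Set.mem_ofPred_eq, Set.mem_singleton_iff]
    refine ⟨fun h => hfi (funext fun i => h (i + 1) i (Nat.lt_succ_self i)), ?_⟩
    rintro rfl _ _ _
    rfl
  have hanti : Antitone fun d : ℕ =>
      (fun x (i : Fin d) => f x i) ⁻¹' {fun i : Fin d => f s i} := by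
    intro d d' hd
    simp only [hset]
    exact fun x hx i hi => hx i (hi.trans_le hd)
  have := tendsto_measure_iInter_atTop (μ := ξ) (fun d => (hm d).nullMeasurableSet) hanti
    ⟨0, measure_ne_top _ _⟩
  rw [hI] at this
  exact (ENNReal.tendsto_toReal (measure_ne_top _ _)).comp this

/-- From `e^{-2y} ≤ 1 - y` for `0 ≤ y ≤ 1/2`, taken at `y = 2/n`; this is where `n ≥ 4` is needed.
-/
lemma exp_neg_four_le_pow {n : ℕ} (hn : 4 ≤ n) : Real.exp (-4) ≤ (1 - 2 / (n : ℝ)) ^ n := by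
  have hn' : (4 : ℝ) ≤ n := by exact_mod_cast hn
  have h0 : (2 : ℝ) / n ≤ 1 / 2 := by
    rw [div_le_div_iff₀ (by positivity) (by norm_num)]; linarith
  have h00 : (0 : ℝ) < 2 / n := by positivity
  have h1 : Real.exp (-(4 / n)) ≤ 1 - 2 / n := by
    rw [Real.exp_neg, inv_le_comm₀ (Real.exp_pos _) (by linarith)]
    have h2 := Real.add_one_le_exp (4 / n : ℝ)
    refine le_trans ?_ h2
    have h3 : (4 : ℝ) / n = 2 * (2 / n) := by ring
    rw [h3, inv_le_comm₀ (by linarith) (by linarith), inv_le_iff_one_le_mul₀ (by linarith)]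
    nlinarith
  have h2 := pow_le_pow_left₀ (Real.exp_pos _).le h1 n
  rw [← Real.exp_nat_mul] at h2
  have h3 : (n : ℝ) * -(4 / n) = -4 := by field_simp
  rwa [h3] at h2

/-- The variance of `Z²` is nonnegative. Together with `8 M² ≤ n` this forces `n ≥ 8` unless `Z`
vanishes almost surely. -/
lemma one_le_momentRatio_sq {Ω : Type*} [MeasurableSpace Ω] {P : Measure Ω}
    [IsProbabilityMeasure P] {Z : Ω → ℝ} (h : MemLp Z 4 P) (hV : 0 < ∫ x, Z x ^ 2 ∂P) :
    1 ≤ momentRatio P Z ^ 2 := by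
  have h4 := integral_pow_four_eq_momentRatio hV
  have h4i := integrable_pow_four_of_memLp h
  have h2i := integrable_sq_of_memLp h
  set V := ∫ x, Z x ^ 2 ∂P with hVd
  have e1 : 0 ≤ ∫ x, (Z x ^ 4 - 2 * V * Z x ^ 2 + V ^ 2) ∂P := by
    refine integral_nonneg fun x => ?_
    have : Z x ^ 4 - 2 * V * Z x ^ 2 + V ^ 2 = (Z x ^ 2 - V) ^ 2 := by ring
    simp only [this, Pi.zero_apply]
    positivity
  have i1 : Integrable (fun x => Z x ^ 4 - 2 * V * Z x ^ 2) P := h4i.sub (h2i.const_mul _)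
  rw [integral_add i1 (integrable_const _), integral_sub h4i (h2i.const_mul _),
    integral_const_mul, ← hVd, h4] at e1
  simp only [integral_const, probReal_univ, smul_eq_mul, one_mul] at e1
  have hV2 : 0 < V ^ 2 := by positivity
  by_contra hlt
  push Not at hlt
  nlinarith

/-- A nonnegative finitely valued function, at most `1`, that is nearly proportional to a truncation
of `|Z|`. -/
lemma exists_levels {Ω : Type*} [MeasurableSpace Ω] {P : Measure Ω} [IsProbabilityMeasure P]
    {Z : Ω → ℝ} (hZm : Measurable Z) (hZ4 : MemLp Z 4 P) (hV0 : 0 < ∫ x, Z x ^ 2 ∂P) {n : ℕ}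
    (hM : 8 * momentRatio P Z ^ 2 ≤ n) {t : ℝ} (ht0 : 0 < t)
    (ht2 : t ^ 2 * (n * ∫ x, Z x ^ 2 ∂P) = 1) :
    ∃ (L : ℕ) (N : Ω → Fin (L + 1)) (v : Fin (L + 1) → ℝ), Measurable N ∧ (∀ j, 0 ≤ v j) ∧
      (∀ j, v j ≤ 1) ∧ (∀ x, v (N x) ^ 2 ≤ t ^ 2 * Z x ^ 2) ∧
      t * (5 / 8 * ∫ x, Z x ^ 2 ∂P) ≤ ∫ x, v (N x) * |Z x| ∂P := by
  have hZ2i := integrable_sq_of_memLp hZ4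
  have hZi : Integrable Z P := hZ4.integrable (by norm_num)
  set V := ∫ x, Z x ^ 2 ∂P with hVdef
  -- Mesh for rounding the truncated `|Z|` down to finitely many levels. Rounding costs at most `η
  -- E|Z| ≤ V/8 + E Z²/8 = V/4`, which turns `7/8` into `5/8`.
  set η := √V / 4 with hη
  have hη0 : 0 < η := by positivity
  let W : Ω → ℝ := fun p => truncate t |Z p|
  have hWm : Measurable W := (measurable_truncate t).comp hZm.abs
  have hW0 : ∀ p, 0 ≤ W p := fun p => truncate_nonneg t (abs_nonneg _)
  have hWZ : ∀ p, W p ≤ |Z p| := fun p => truncate_le_self t (abs_nonneg _)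
  have hWt : ∀ p, W p ≤ 1 / (2 * t) := fun p => by
    have := (le_abs_self _).trans (abs_mul_truncate_le t |Z p|)
    rw [le_div_iff₀ (by positivity)]
    change t * W p ≤ 1 / 2 at this
    linarith
  let N : Ω → ℕ := fun p => ⌊W p / η⌋₊
  have hNm : Measurable N := Nat.measurable_floor.comp (hWm.div_const η)
  let L := ⌊1 / (2 * t) / η⌋₊
  have hNL : ∀ p, N p < L + 1 := fun p =>
    Nat.lt_succ_of_le (Nat.floor_le_floor (div_le_div_of_nonneg_right (hWt p) hη0.le))
  have hηN : ∀ p, η * N p ≤ W p := fun p => by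
    have := Nat.floor_le (div_nonneg (hW0 p) hη0.le)
    rw [le_div_iff₀ hη0] at this
    rw [mul_comm]; exact this
  have hηN' : ∀ p, W p - η ≤ η * N p := fun p => by
    have := (Nat.lt_floor_add_one (W p / η)).le
    rw [div_le_iff₀ hη0] at this
    change W p ≤ (N p + 1) * η at this
    linarith
  let U : Ω → ℝ := fun p => t * (η * N p)
  have hUm : Measurable U := by
    have : Measurable fun p => (N p : ℝ) := (measurable_of_countable _).comp hNm
    exact (this.const_mul η).const_mul t
  have hU0 : ∀ p, 0 ≤ U p := fun p => by positivity
  have hUZ : ∀ p, U p ≤ t * |Z p| := fun p =>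
    mul_le_mul_of_nonneg_left ((hηN p).trans (hWZ p)) ht0.le
  have hU2 : ∀ p, U p ^ 2 ≤ t ^ 2 * Z p ^ 2 := fun p => by
    have := pow_le_pow_left₀ (hU0 p) (hUZ p) 2
    rwa [mul_pow t |Z p|, sq_abs] at this
  have hv1 : ∀ j : Fin (L + 1), t * (η * (j : ℕ)) ≤ 1 := fun j => by
    have h1 : ((j : ℕ) : ℝ) ≤ 1 / (2 * t) / η :=
      (Nat.cast_le.2 (Nat.lt_succ_iff.1 j.2)).trans (Nat.floor_le (by positivity))
    have h2 : t * (η * (1 / (2 * t) / η)) = 1 / 2 := by field_simp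
    have h3 : t * (η * (j : ℕ)) ≤ t * (η * (1 / (2 * t) / η)) := by gcongr
    linarith
  have hU1 : ∀ p, U p ≤ 1 := fun p => hv1 ⟨N p, hNL p⟩
  have hUZi : Integrable (fun p => U p * |Z p|) P :=
    hZi.abs.bdd_mul (c := 1) hUm.aestronglyMeasurable (Filter.Eventually.of_forall fun p => by
      rw [Real.norm_of_nonneg (hU0 p)]; exact hU1 p)
  have hmain : t * (5 / 8 * V) ≤ ∫ p, U p * |Z p| ∂P := by
    have hZtr : ∀ p, Z p * truncate t (Z p) = |Z p| * W p := fun p => by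
      simp only [W, truncate, sq_abs]
      rw [← mul_div_assoc, ← mul_div_assoc, abs_mul_abs_self]
    have hZtri : Integrable (fun p => Z p * truncate t (Z p)) P := by
      simp_rw [hZtr]
      refine hZ2i.mono' (hZm.abs.mul hWm).aestronglyMeasurable
        (Filter.Eventually.of_forall fun p => ?_)
      rw [Real.norm_of_nonneg (mul_nonneg (abs_nonneg _) (hW0 p)), ← sq_abs, sq]
      exact mul_le_mul_of_nonneg_left (hWZ p) (abs_nonneg _)
    have e1 := integral_mul_truncate_ge hZ4 hV0 hM ht2 hZtri
    have e2 : ∫ p, t * (Z p * truncate t (Z p) - (V / 8 + Z p ^ 2 / 8)) ∂P ≤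
        ∫ p, U p * |Z p| ∂P := by
      refine integral_mono ((hZtri.sub ((integrable_const _).add (hZ2i.div_const _))).const_mul _)
        hUZi fun p => ?_
      simp only [U]
      rw [mul_assoc, hZtr]
      refine mul_le_mul_of_nonneg_left ?_ ht0.le
      have h1 := mul_le_mul_of_nonneg_right (hηN' p) (abs_nonneg (Z p))
      have h2 : η * |Z p| ≤ V / 8 + Z p ^ 2 / 8 := by
        rw [hη, ← sq_abs (Z p)]
        nlinarith [Real.sq_sqrt hV0.le, sq_nonneg (√V - |Z p|)]
      nlinarith
    have i1 : Integrable (fun p => V / 8 + Z p ^ 2 / 8) P :=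
      (integrable_const _).add (hZ2i.div_const _)
    rw [integral_const_mul, integral_sub hZtri i1, integral_add (integrable_const _)
      (hZ2i.div_const _), integral_div, integral_div, ← hVdef] at e2
    simp only [integral_const, probReal_univ, smul_eq_mul, one_mul] at e2
    refine le_trans (mul_le_mul_of_nonneg_left ?_ ht0.le) e2
    linarith
  refine ⟨L, fun x => ⟨N x, hNL x⟩, fun j => t * (η * (j : ℕ)), ?_, fun j => by positivity, hv1,
    hU2, hmain⟩
  refine measurable_to_countable' fun j => ?_
  have : (fun p => (⟨N p, hNL p⟩ : Fin (L + 1))) ⁻¹' {j} = N ⁻¹' {(j : ℕ)} := by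
    ext p; simp [Fin.ext_iff]
  rw [this]
  exact hNm (measurableSet_singleton _)

lemma integral_unvisited_nonneg {Ω J : Type*} [MeasurableSpace Ω] [DecidableEq J] (P : Measure Ω)
    (C : Ω → J) {u : J → ℝ} (hu0 : ∀ c, 0 ≤ u c) (hu1 : ∀ c, u c ≤ 1) (c : J) :
    0 ≤ ∫ p, (if C p = c then 0 else 1 - u (C p) ^ 2) ∂P := by
  refine integral_nonneg fun p => ?_
  have h0 := hu0 (C p)
  have h1 := hu1 (C p)
  simp only [Pi.zero_apply]
  split_ifs
  · exact le_rfl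
  · nlinarith

/-- Pointwise union bound: the integrand is at least `1 - 1_{C = c} - u²`. -/
lemma one_sub_le_integral_unvisited {Ω J : Type*} [MeasurableSpace Ω] [DecidableEq J]
    [MeasurableSpace J] [DiscreteMeasurableSpace J] [Countable J] {P : Measure Ω}
    [IsProbabilityMeasure P] {C : Ω → J} (hC : Measurable C) {u : J → ℝ} (hu0 : ∀ c, 0 ≤ u c)
    (hu1 : ∀ c, u c ≤ 1) (c : J) :
    1 - P.real (C ⁻¹' {c}) - ∫ p, u (C p) ^ 2 ∂P ≤
      ∫ p, (if C p = c then 0 else 1 - u (C p) ^ 2) ∂P := by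
  have hb : ∀ c, 0 ≤ u c ^ 2 ∧ u c ^ 2 ≤ 1 := fun c =>
    ⟨sq_nonneg _, pow_le_one₀ (hu0 c) (hu1 c)⟩
  have hCc : MeasurableSet (C ⁻¹' {c}) := hC MeasurableSet.of_discrete
  have hU2i : Integrable (fun p => u (C p) ^ 2) P :=
    Integrable.of_bound (C := 1)
      ((measurable_of_countable fun j => u j ^ 2).comp hC).aestronglyMeasurable
      (Filter.Eventually.of_forall fun p => by
        rw [Real.norm_of_nonneg (hb _).1]; exact (hb _).2)
  have hi : Integrable ((C ⁻¹' {c}).indicator fun _ => (1 : ℝ)) P :=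
    (integrable_const _).indicator hCc
  have i1 : Integrable (fun p => 1 - (C ⁻¹' {c}).indicator (fun _ => (1 : ℝ)) p) P :=
    (integrable_const _).sub hi
  have h3 : ∫ p, (1 - (C ⁻¹' {c}).indicator (fun _ => (1 : ℝ)) p - u (C p) ^ 2) ∂P ≤
      ∫ p, (if C p = c then 0 else 1 - u (C p) ^ 2) ∂P := by
    refine integral_mono (i1.sub hU2i) ?_ fun p => ?_
    · refine Integrable.of_bound (C := 1) ((measurable_of_countable fun j =>
        if j = c then (0 : ℝ) else 1 - u j ^ 2).comp hC).aestronglyMeasurable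
        (Filter.Eventually.of_forall fun p => ?_)
      obtain ⟨h0, h1⟩ := hb (C p)
      rw [Real.norm_eq_abs, abs_le]
      split_ifs <;> constructor <;> linarith
    · obtain ⟨h0, h1⟩ := hb (C p)
      by_cases hp : C p = c
      · simp only [hp, Set.indicator, Set.mem_preimage, Set.mem_singleton_iff, if_true]
        rw [← hp]; linarith
      · simp only [hp, Set.indicator, Set.mem_preimage, Set.mem_singleton_iff, if_false]
        linarith
  rw [integral_sub i1 hU2i, integral_sub (integrable_const _) hi,
    integral_indicator_const _ hCc] at h3
  simp only [integral_const, probReal_univ, smul_eq_mul, mul_one] at h3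
  exact h3

/-- The contribution of the width of the band to the minimax risk, when no state has mass above
`1 / n`. -/
lemma minimaxRisk_ge_band [MeasurableSpace.CountablySeparated X] (lam : Measure A) [SFinite lam]
    {pol g muStar sig del : X × A → ℝ} {ξ : Measure X} [IsProbabilityMeasure ξ]
    {K : Set (Kernel (X × A) ℝ)} {n : ℕ}
    (hpol : Measurable pol) (hg : Measurable g) (hmu : Measurable muStar)
    (hsig : Measurable sig) (hdel : Measurable del) (hpol0 : ∀ p, 0 ≤ pol p)
    (hpol1 : ∀ s, ∫⁻ a, ENNReal.ofReal (pol (s, a)) ∂lam = 1)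
    (hgpol : ∀ p, pol p = 0 → g p = 0)
    (hgmu : Integrable (fun p => g p * muStar p) (ξ.prod lam))
    (hK : ∀ (mu : X × A → ℝ) (hmu : Measurable mu), mu ∈ valueNbhd muStar del →
      gaussianOutcome mu sig hmu hsig ∈ K)
    (hdel0 : ∀ p, 0 ≤ del p)
    (hZ4 : MemLp (perturbVar pol g del) 4 (stateActionLaw lam pol ξ))
    (hn : 1 ≤ n) (hM : 8 * momentRatio (stateActionLaw lam pol ξ) (perturbVar pol g del) ^ 2 ≤ n)
    (hξ : ∀ s, ξ.real {s} ≤ 1 / n) :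
    ENNReal.ofReal (Real.exp (-8) / 4 * (weightedNormSq lam pol g ξ del / n)) ≤
      minimaxRisk n lam pol g (localClass n lam g K ξ muStar sig del) := by
  have hn' : (1 : ℝ) ≤ n := by exact_mod_cast hn
  have hPp := isProbabilityMeasure_stateActionLaw lam hpol hpol1 ξ
  set P := stateActionLaw lam pol ξ with hP
  set Z := perturbVar pol g del with hZdef
  have hZm : Measurable Z := (hdel.mul hg).div hpol
  have hZ2i := integrable_sq_of_memLp hZ4
  have hZi : Integrable Z P := hZ4.integrable (by norm_num)
  have hpolZ : ∀ p, pol p * Z p ^ 2 = g p ^ 2 / pol p * del p ^ 2 := fun p => by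
    simp only [hZdef, perturbVar]
    rcases eq_or_ne (pol p) 0 with h | h
    · simp [h]
    · field_simp
  have hV : weightedNormSq lam pol g ξ del = ∫ p, Z p ^ 2 ∂P := by
    have hi := (integrable_stateActionLaw_iff lam hpol hpol0 ξ _).1 hZ2i
    rw [integral_stateActionLaw lam hpol hpol0]
    simp_rw [hpolZ] at hi ⊢
    exact weightedNormSq_eq_integral lam ξ hi
  rw [hV]
  set V := ∫ p, Z p ^ 2 ∂P with hVdef
  rcases le_or_gt V 0 with hV0 | hV0
  · rw [ENNReal.ofReal_of_nonpos]
    · exact bot_le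
    · have : V / n ≤ 0 := div_nonpos_of_nonpos_of_nonneg hV0 (by linarith)
      nlinarith [Real.exp_pos (-8)]
  have hn8 : 4 ≤ n := by
    have h1 := one_le_momentRatio_sq hZ4 hV0
    have : (4 : ℝ) ≤ n := by linarith
    exact_mod_cast this
  have hnV : 0 < n * V := by positivity
  set t := 1 / √(n * V) with ht
  have ht0 : 0 < t := by positivity
  have ht2 : t ^ 2 * (n * V) = 1 := by
    rw [ht, div_pow, Real.sq_sqrt hnV.le]; field_simp
  have ht2V : t ^ 2 * V = 1 / n := by rw [eq_div_iff (by positivity)]; linarith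
  obtain ⟨L, N, v, hN, hv0, hv1, hvZ, hmain⟩ := exists_levels hZm hZ4 hV0 hM ht0 ht2
  rw [← hVdef] at hmain
  let U : X × A → ℝ := fun p => v (N p)
  have hUm : Measurable U := (measurable_of_countable v).comp hN
  have hU0 : ∀ p, 0 ≤ U p := fun p => hv0 _
  have hU1 : ∀ p, U p ≤ 1 := fun p => hv1 _
  have hU2 : ∀ p, U p ^ 2 ≤ t ^ 2 * Z p ^ 2 := hvZ
  have hU2i : Integrable (fun p => U p ^ 2) P :=
    (hZ2i.const_mul (t ^ 2)).mono' (by fun_prop) (Filter.Eventually.of_forall fun p => by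
      rw [Real.norm_of_nonneg (sq_nonneg _)]; exact hU2 p)
  have hU2I : ∫ p, U p ^ 2 ∂P ≤ 1 / n := by
    rw [← ht2V, hVdef, ← integral_const_mul]
    exact integral_mono hU2i (hZ2i.const_mul _) hU2
  have hUZi : Integrable (fun p => U p * |Z p|) P :=
    hZi.abs.bdd_mul (c := 1) hUm.aestronglyMeasurable (Filter.Eventually.of_forall fun p => by
      rw [Real.norm_of_nonneg (hU0 p)]; exact hU1 p)
  -- A countable separating family embeds `X` into Cantor space; the first `d` bits give finite
  -- measurable partitions whose fibers shrink to points.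
  obtain ⟨f, hf, hfi⟩ := MeasurableSpace.measurable_injection_nat_bool_of_countablySeparated X
  let bits : (d : ℕ) → X → Fin d → Bool := fun d x i => f x i
  have hbits : ∀ d, Measurable (bits d) := fun d =>
    measurable_pi_lambda _ fun i : Fin d => (measurable_pi_apply (i : ℕ)).comp hf
  -- Lower bound for the one-sample factor of a cell. The positive part keeps the base of the `n`-th
  -- power nonnegative for coarse partitions.
  let r : (d : ℕ) → (Fin d → Bool) → ℝ := fun d i => max 0 (1 - ξ.real (bits d ⁻¹' {i}) - 1 / n)
  have hr0 : ∀ d i, 0 ≤ r d i := fun d i => le_max_left _ _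
  have hr1 : ∀ d i, r d i ≤ 1 := fun d i => by
    refine max_le zero_le_one ?_
    have h1 : 0 ≤ ξ.real (bits d ⁻¹' {i}) := measureReal_nonneg
    have h2 : (0 : ℝ) ≤ 1 / n := by positivity
    linarith
  have hrlim : ∀ s, Filter.Tendsto (fun d => r d (bits d s)) Filter.atTop
      (nhds (max 0 (1 - ξ.real {s} - 1 / n))) := fun s =>
    tendsto_const_nhds.max
      ((tendsto_const_nhds.sub (tendsto_measureReal_fiber ξ hf hfi s)).sub_const _)
  have hrm : ∀ d, Measurable fun s => r d (bits d s) := fun d =>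
    (measurable_of_countable (r d)).comp (hbits d)
  have hqm : Measurable fun s => max 0 (1 - ξ.real {s} - 1 / (n : ℝ)) :=
    measurable_of_tendsto_metrizable hrm (tendsto_pi_nhds.2 hrlim)
  have hlim : Filter.Tendsto (fun d => ∫ p, r d (bits d p.1) ^ n * (U p * |Z p|) ∂P) Filter.atTop
      (nhds (∫ p, max 0 (1 - ξ.real {p.1} - 1 / n) ^ n * (U p * |Z p|) ∂P)) := by
    refine tendsto_integral_of_dominated_convergence (fun p => U p * |Z p|) (fun d => ?_) hUZi
      (fun d => Filter.Eventually.of_forall fun p => ?_) (Filter.Eventually.of_forall fun p => ?_)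
    · exact ((((hrm d).comp measurable_fst).pow_const n).mul (hUm.mul hZm.abs)).aestronglyMeasurable
    · have h1 := mul_nonneg (hU0 p) (abs_nonneg (Z p))
      rw [Real.norm_of_nonneg (mul_nonneg (pow_nonneg (hr0 _ _) _) h1)]
      exact mul_le_of_le_one_left h1 (pow_le_one₀ (hr0 _ _) (hr1 _ _))
    · exact ((hrlim p.1).pow n).mul_const _
  have hlim2 : Real.exp (-4) * (t * (5 / 8 * V)) ≤
      ∫ p, max 0 (1 - ξ.real {p.1} - 1 / n) ^ n * (U p * |Z p|) ∂P := by
    have h1 : ∀ p : X × A, Real.exp (-4) ≤ max 0 (1 - ξ.real {p.1} - 1 / (n : ℝ)) ^ n := by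
      intro p
      refine (exp_neg_four_le_pow hn8).trans (pow_le_pow_left₀ ?_ ?_ n)
      · have : (4 : ℝ) ≤ n := by exact_mod_cast hn8
        rw [sub_nonneg, div_le_one (by linarith)]; linarith
      · refine le_trans ?_ (le_max_right _ _)
        have h2 := hξ p.1
        have h3 : (2 : ℝ) / n = 1 / n + 1 / n := by ring
        linarith
    calc _ ≤ Real.exp (-4) * ∫ p, U p * |Z p| ∂P :=
          mul_le_mul_of_nonneg_left hmain (Real.exp_pos _).le
      _ = ∫ p, Real.exp (-4) * (U p * |Z p|) ∂P := (integral_const_mul _ _).symm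
      _ ≤ _ := by
          refine integral_mono_of_nonneg (Filter.Eventually.of_forall fun p =>
            mul_nonneg (Real.exp_pos _).le (mul_nonneg (hU0 p) (abs_nonneg _))) ?_
            (Filter.Eventually.of_forall fun p =>
              mul_le_mul_of_nonneg_right (h1 p) (mul_nonneg (hU0 p) (abs_nonneg _)))
          exact hUZi.bdd_mul (c := 1)
            ((hqm.comp measurable_fst).pow_const n).aestronglyMeasurable
            (Filter.Eventually.of_forall fun p => by
              rw [Real.norm_of_nonneg (pow_nonneg (le_max_left _ _) _)]
              refine pow_le_one₀ (le_max_left _ _) (max_le zero_le_one ?_)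
              have h2 : 0 ≤ ξ.real {p.1} := measureReal_nonneg
              have h3 : (0 : ℝ) ≤ 1 / n := by positivity
              linarith)
  have htV : 0 < t * V := by positivity
  -- The slack between `5/8` and `1/2` makes the inequality strict, so it already holds at some
  -- finite depth `d`.
  have hlt : Real.exp (-4) * (t * V) / 2 <
      ∫ p, max 0 (1 - ξ.real {p.1} - 1 / n) ^ n * (U p * |Z p|) ∂P := by
    refine lt_of_lt_of_le ?_ hlim2
    have := mul_pos (Real.exp_pos (-4)) htV
    nlinarith
  obtain ⟨d, hd⟩ := (hlim.eventually (lt_mem_nhds hlt)).exists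
  let C : X × A → (Fin d → Bool) × Fin (L + 1) := fun p => (bits d p.1, N p)
  have hC : Measurable C := ((hbits d).comp measurable_fst).prodMk hN
  let u : (Fin d → Bool) × Fin (L + 1) → ℝ := fun c => v c.2
  have hu0 : ∀ c, 0 ≤ u c := fun c => hv0 _
  have hu1 : ∀ c, u c ≤ 1 := fun c => hv1 _
  have key := minimaxRisk_ge_of_cells (n := n) lam hpol hg hmu hsig hdel hpol0 hpol1 hgpol hgmu hK hdel0
    hZi C hC u hu0 hu1
  refine le_trans (ENNReal.ofReal_le_ofReal ?_) key
  -- A cell lies over a single set of states, so its mass is at most that of this set, however the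
  -- actions and levels are distributed.
  have hq : ∀ c, r d c.1 ≤ ∫ p, (if C p = c then 0 else 1 - u (C p) ^ 2) ∂P := by
    intro c
    refine max_le (integral_unvisited_nonneg P C hu0 hu1 c) ?_
    have h1 : P.real (C ⁻¹' {c}) ≤ ξ.real (bits d ⁻¹' {c.1}) := by
      have h2 : ξ.real (bits d ⁻¹' {c.1}) = P.real (Prod.fst ⁻¹' (bits d ⁻¹' {c.1})) := by
        conv_lhs => rw [← map_fst_stateActionLaw lam hpol hpol1 ξ]
        rw [map_measureReal_apply measurable_fst (hbits d MeasurableSet.of_discrete)]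
      rw [h2]
      refine measureReal_mono fun p hp => ?_
      have hp' : C p = c := hp
      rw [← hp']; rfl
    have h3 := one_sub_le_integral_unvisited (P := P) hC hu0 hu1 c
    have h4 : ∫ p, u (C p) ^ 2 ∂P ≤ 1 / n := hU2I
    linarith
  have hsum : ∫ p, r d (bits d p.1) ^ n * (U p * |Z p|) ∂P =
      ∑ c, (∫ p in C ⁻¹' {c}, |Z p| ∂P) * (r d c.1 ^ n * u c) := by
    rw [← integral_comp_cell_mul hC hZi.abs fun c => r d c.1 ^ n * u c]
    exact integral_congr_ae (Filter.Eventually.of_forall fun p => (mul_assoc _ _ _).symm)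
  have hle : ∑ c, (∫ p in C ⁻¹' {c}, |Z p| ∂P) * (r d c.1 ^ n * u c) ≤
      ∑ c, (∫ p in C ⁻¹' {c}, |Z p| ∂P) * u c *
        (∫ p, (if C p = c then 0 else 1 - u (C p) ^ 2) ∂P) ^ n := by
    refine Finset.sum_le_sum fun c _ => ?_
    rw [mul_comm (r d c.1 ^ n), ← mul_assoc]
    exact mul_le_mul_of_nonneg_left (pow_le_pow_left₀ (hr0 _ _) (hq c) n)
      (mul_nonneg (integral_nonneg fun p => abs_nonneg _) (hu0 c))
  have hfin := (hd.le.trans hsum.le).trans hle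
  have hsq := pow_le_pow_left₀ (by positivity) hfin 2
  refine le_trans (le_of_eq ?_) hsq
  have h8 : Real.exp (-8) = Real.exp (-4) ^ 2 := by
    rw [← Real.exp_nat_mul]; norm_num
  rw [h8]
  calc _ = Real.exp (-4) ^ 2 / 4 * (V * (1 / n)) := by ring
    _ = Real.exp (-4) ^ 2 / 4 * (V * (t ^ 2 * V)) := by rw [ht2V]
    _ = _ := by ring

end Band

/-! ### Assembling the three bounds -/

lemma ofReal_mul_add_add_le {k a b d : ℝ} {M : ℝ≥0∞} (hk : 0 ≤ k)
    (ha : ENNReal.ofReal (k * a) ≤ M) (hb : ENNReal.ofReal (k * b) ≤ M)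
    (hd : ENNReal.ofReal (k * d) ≤ M) : ENNReal.ofReal (k / 3 * (a + b + d)) ≤ M := by
  have h : a + b + d ≤ 3 * max (max a b) d := by
    have h1 := (le_max_left a b).trans (le_max_left _ d)
    have h2 := (le_max_right a b).trans (le_max_left _ d)
    have h3 := le_max_right (max a b) d
    linarith
  have h4 : ENNReal.ofReal (k * max (max a b) d) ≤ M := by
    rcases max_choice (max a b) d with h5 | h5 <;> rw [h5]
    · rcases max_choice a b with h6 | h6 <;> rw [h6] <;> assumption
    · exact hd
  refine (ENNReal.ofReal_le_ofReal ?_).trans h4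
  nlinarith

/-- In the finite case `n < |X| / cmax` rearranges to `cmax / |X| < 1/n`; in the infinite case there
are no atoms. `Nat.card` is `0` for infinite types, hence the separate disjunct. -/
lemma Compatible.measureReal_singleton_le {X : Type*} [MeasurableSpace X] {ξ : Measure X}
    {cmax : ℝ} (h : Compatible ξ cmax) (hc : 0 < cmax) {n : ℕ} (hn : 1 ≤ n)
    (hX : Infinite X ∨ (n : ℝ) < Nat.card X / cmax) (s : X) : ξ.real {s} ≤ 1 / n := by
  have hn' : (1 : ℝ) ≤ n := by exact_mod_cast hn
  rcases finite_or_infinite X with hf | hi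
  · have hlt : (n : ℝ) < Nat.card X / cmax := hX.resolve_left (not_infinite_iff_finite.2 hf)
    rw [lt_div_iff₀ hc] at hlt
    have hcard : (0 : ℝ) < Nat.card X := by nlinarith
    refine (h.1 hf s).trans ?_
    rw [div_le_div_iff₀ hcard (by linarith)]
    linarith
  · rw [measureReal_def, (h.2 hi).2 s]
    simp

end LocalMinimax
end

theorem theorem3 :
    ∃ c c' : ℝ, 0 < c ∧ 0 < c' ∧
      ∀ (X : Type*) (A : Type*) [MeasurableSpace X] [MeasurableSpace A]
        [MeasurableSpace.CountablySeparated X]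
        (lam : Measure A) [SFinite lam]
        (pol g muStar sig del : X × A → ℝ) (ξStar : Measure X) [IsProbabilityMeasure ξStar]
        (K : Set (Kernel (X × A) ℝ)) (n : ℕ) (cmax : ℝ)
        -- measurability of the data of the problem
        (_ : Measurable pol) (_ : Measurable g) (_ : Measurable muStar)
        (hsig : Measurable sig) (_ : Measurable del)
        -- each `pol (s, ·)` is a probability density with respect to `lam`
        (_ : ∀ p, 0 ≤ pol p)
        (_ : ∀ s, ∫⁻ a, ENNReal.ofReal (pol (s, a)) ∂lam = 1)
        -- the ratio `g / pol` makes sense: `g` vanishes where `pol` does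
        (_ : ∀ p, pol p = 0 → g p = 0)
        -- the functional and the weighted norm of `sig` are well defined at the target instance
        (_ : Integrable (fun p => g p * muStar p) (ξStar.prod lam))
        (_ : Integrable (fun p => g p ^ 2 / pol p * sig p ^ 2) (ξStar.prod lam))
        -- the outcome laws under consideration include the Gaussian ones
        (_ : ∀ (mu : X × A → ℝ) (hmu : Measurable mu), mu ∈ LocalMinimax.valueNbhd muStar del →
          LocalMinimax.gaussianOutcome mu sig hmu hsig ∈ K)
        -- finite moment ratios
        (_ : MemLp (LocalMinimax.perturbVar pol g del) 4
          (LocalMinimax.stateActionLaw lam pol ξStar))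
        (_ : MemLp (LocalMinimax.centeredVar lam g ξStar muStar) 4 ξStar)
        -- compatibility
        (_ : 0 < cmax) (_ : LocalMinimax.Compatible ξStar cmax)
        -- local neighborhood size
        (_ : ∀ p, 0 ≤ del p)
        (_ : ∀ p, |g p| * sig p ^ 2 /
            (pol p * LocalMinimax.weightedNorm lam pol g ξStar sig) ≤ Real.sqrt n * del p)
        -- sample size
        (_ : 1 ≤ n)
        (_ : c' * max
            (LocalMinimax.momentRatio ξStar (LocalMinimax.centeredVar lam g ξStar muStar) ^ 2)
            (LocalMinimax.momentRatio (LocalMinimax.stateActionLaw lam pol ξStar)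
              (LocalMinimax.perturbVar pol g del) ^ 2) ≤ n),
        ENNReal.ofReal (c / n * LocalMinimax.efficientVar lam pol g ξStar muStar sig) ≤
            LocalMinimax.minimaxRisk n lam pol g
              (LocalMinimax.localClass n lam g K ξStar muStar sig del) ∧
          (Infinite X ∨ (n : ℝ) < Nat.card X / cmax →
            ENNReal.ofReal (c / n * (LocalMinimax.efficientVar lam pol g ξStar muStar sig +
                LocalMinimax.weightedNormSq lam pol g ξStar del)) ≤
              LocalMinimax.minimaxRisk n lam pol g
                (LocalMinimax.localClass n lam g K ξStar muStar sig del)) := by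
  -- `e^{-8}/64` lies below the three constants `1/16`, `1/64` and `e^{-8}/4`; the `3` pays for
  -- passing from the maximum to the sum. The `8` keeps the truncation loss below `1/8`.
  refine ⟨Real.exp (-8) / 64 / 3, 8, by positivity, by norm_num, ?_⟩
  intro X A _ _ _ lam _ pol g muStar sig del ξ _ K n cmax hpol hg hmu hsig hdel hpol0 hpol1 hgpol
    hgmu hgsig hK hZ4 hZ4' hc hcomp hdel0 hnb hn hM
  have hexp : Real.exp (-8) ≤ 1 := Real.exp_le_one_iff.2 (by norm_num)
  have hexp0 := Real.exp_pos (-8)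
  have hM1 : 8 * LocalMinimax.momentRatio ξ (LocalMinimax.centeredVar lam g ξ muStar) ^ 2 ≤ n :=
    (mul_le_mul_of_nonneg_left (le_max_left _ _) (by norm_num)).trans hM
  have hM2 : 8 * LocalMinimax.momentRatio (LocalMinimax.stateActionLaw lam pol ξ)
      (LocalMinimax.perturbVar pol g del) ^ 2 ≤ n :=
    (mul_le_mul_of_nonneg_left (le_max_right _ _) (by norm_num)).trans hM
  have shrink : ∀ {k x : ℝ} {M : ℝ≥0∞}, Real.exp (-8) / 64 ≤ k → ENNReal.ofReal (k * x) ≤ M →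
      ENNReal.ofReal (Real.exp (-8) / 64 * x) ≤ M := by
    intro k x M hk h
    rcases le_total 0 x with hx | hx
    · exact (ENNReal.ofReal_le_ofReal (mul_le_mul_of_nonneg_right hk hx)).trans h
    · rw [ENNReal.ofReal_of_nonpos (mul_nonpos_of_nonneg_of_nonpos (by positivity) hx)]
      exact bot_le
  have hvar := shrink (by linarith)
    (LocalMinimax.minimaxRisk_ge_variance lam hpol hg hmu hsig hpol1 hgmu hK hdel0 hZ4' hn hM1)
  have hnoise := shrink (by linarith)
    (LocalMinimax.minimaxRisk_ge_noise lam hpol hg hmu hsig hpol0 hpol1 hgmu hgsig hK hdel0 hnb hn)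
  refine ⟨?_, fun hX => ?_⟩
  -- Without the condition on the number of states the band term is replaced by `0`.
  · have := LocalMinimax.ofReal_mul_add_add_le (d := 0) (by positivity) hvar hnoise (by simp)
    convert this using 2
    unfold LocalMinimax.efficientVar
    ring
  · have hband := shrink (by linarith)
      (LocalMinimax.minimaxRisk_ge_band lam hpol hg hmu hsig hdel hpol0 hpol1 hgpol hgmu hK hdel0
        hZ4 hn hM2 (hcomp.measureReal_singleton_le hc hn hX))
    have := LocalMinimax.ofReal_mul_add_add_le (by positivity) hvar hnoise hband
    convert this using 2
    unfold LocalMinimax.efficientVar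
    ring
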